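/- Let $\theta$ be a finite signature consisting of function symbols only, and let $\mathcal A=\langle A,\theta\rangle$ be a uniformly locally compact algebra of signature $\theta$: $A$ is a Hausdorff uniform space with uniformity $\mathcal W$, there is a $W\in\mathcal W$ such that $W(x)=\{y\in A : (x,y)\in W\}$ is relatively compact for every $x\in A$, and every $f\in\theta$ is interpreted in $A$ by a continuous operation, also denoted $f$. Let $\mathcal K$ be a class of finite algebras of signature $\theta$. For a compact set $C\subseteq A$ and $W\in\mathcal W$, a pair $\langle\mathcal B,j\rangle$ of an algebra $\mathcal B=\langle B,\theta\rangle$ and a map $j:B\to A$ is a $(C,W)$-approximation of $\mathcal A$ if (i) for every $x\in C$ there is $b\in B$ with $(x,j(b))\in W$, and (ii) for every $n$-ary $f\in\theta$ and $\bar b\in B^n$ with $j(\bar b)\in C^n$ and $f(j(\bar b))\in C$ one has $\bigl(f(j(\bar b)),\,j(f_B(\bar b))\bigr)\in W$, where $f_B$ interprets $f$ in $\mathcal B$. The algebra $\mathcal A$ is approximable by finite $\mathcal K$-algebras if for every compact $C\subseteq A$ and every $W\in\mathcal W$ all of whose sections $W(x)$ are relatively compact there is a $(C,W)$-approximation $\langle\mathcal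 B,j\rangle$ of $\mathcal A$ with $\mathcal B\in\mathcal K$. Let $\kappa$ be an infinite cardinal such that both the topology and the uniformity of $A$ have a base of cardinality at most $\kappa$, and fix a $\kappa^+$-saturated nonstandard universe (that is, a nonstandard universe in which every family of at most $\kappa$ internal sets with the finite intersection property has nonempty intersection) whose standard superstructure contains $A$ and $\mathcal K$ (if $\mathcal K$ is not itself an element of the superstructure, ${}^*\mathcal K$ means ${}^*\mathcal K_0$, where $\mathcal K_0$ is any set in the superstructure that consists of copies of members of $\mathcal K$ and contains a copy of each member of $\mathcal K$). For $\alpha,\beta\in{}^*A$ write $\alpha\approx\beta$ if $(\alpha,\beta)\in{}^*W$ for all $W\in\mathcal W$, and call $\alpha\in{}^*A$ nearstandard if $\alpha\approx a$ for some $a\in A$ (identified with its image in ${}^*A$). Then $\mathcal A$ is approximable by finite $\mathcal K$-algebras if and only if there exist a hyperfinite algebra $\mathcal A_h=\langle A_h,\theta\rangle\in{}^*\mathcal K$ (a hyperfinite set $A_h$ with an internal operation $f_h$ for each $f\in\theta$) and an internal map $j:A_h\to{}^*A$ such that $\langle\mathcal A_h,j\rangle$ is a hyperfinite approximation of $\mathcal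 A$, i.e. 1. for every $a\in A$ there is $b\in A_h$ with $j(b)\approx a$; 2. for every $n$-ary $f\in\theta$ and every $\bar b\in A_h^n$ such that all components of $j(\bar b)$ are nearstandard, $j(f_h(\bar b))\approx f(j(\bar b))$, where $f$ also denotes the nonstandard extension of the operation $f$. -/

import Mathlib

open Set Cardinal Topology Uniformity

universe u s t w

noncomputable section

/-! # Superstructures, bounded formulas and nonstandard universes -/

/-- The stages of the superstructure: `V₀(X) = X` and `Vₙ₊₁(X) = Vₙ(X) ∪ 𝒫(Vₙ(X))`. -/
def stage (X : ZFSet.{u}) : ℕ → ZFSet.{u}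
  | 0 => X
  | n + 1 => stage X n ∪ ZFSet.powerset (stage X n)

/-- The superstructure `V(X) = ⋃ₙ Vₙ(X)`. -/
def superstructure (X : ZFSet.{u}) : Set ZFSet.{u} := {x | ∃ n, x ∈ stage X n}

/-- A base set: its members behave as atoms (individuals) of the superstructure, i.e. they are
different from `∅` and no element of such a member belongs to the superstructure. -/
structure IsBaseSet (X : ZFSet.{u}) : Prop where
  empty_notMem : ∅ ∉ X
  atom : ∀ x ∈ X, ∀ y ∈ x, y ∉ superstructure X

/-- Bounded first-order formulas of the language with equality and membership. The variables are
`v₀, v₁, v₂, …`; the formula `ball i j φ` is `(∀ vᵢ ∈ vⱼ) φ`. -/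
inductive BddFormula : Type
  | mem (i j : ℕ) : BddFormula
  | eq (i j : ℕ) : BddFormula
  | neg (φ : BddFormula) : BddFormula
  | and (φ ψ : BddFormula) : BddFormula
  | ball (i j : ℕ) (φ : BddFormula) : BddFormula

/-- Truth of a bounded formula in the structure `(M, ∈)` under an assignment `v`. -/
def BddFormula.Realize (M : Set ZFSet.{u}) : BddFormula → (ℕ → ZFSet.{u}) → Prop
  | .mem i j, v => v i ∈ v j
  | .eq i j, v => v i = v j
  | .neg φ, v => ¬ φ.Realize M v
  | .and φ ψ, v => φ.Realize M v ∧ ψ.Realize M v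
  | .ball i j φ, v => ∀ z ∈ M, z ∈ v j → φ.Realize M (Function.update v i z)

/-- A nonstandard universe `⟨V(X), V(Y), *⟩`: two infinite base sets and a map
`* : V(X) → V(Y)` with `*X = Y` that satisfies the transfer principle for bounded formulas and
properly extends every infinite set of individuals. (The values of `star` outside `V(X)` are
irrelevant.) -/
structure NonstandardUniverse where
  X : ZFSet.{u}
  Y : ZFSet.{u}
  star : ZFSet.{u} → ZFSet.{u}
  base_X : IsBaseSet X
  base_Y : IsBaseSet Y
  infinite_X : {x | x ∈ X}.Infinite
  infinite_Y : {y | y ∈ Y}.Infinite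
  star_mem : ∀ x ∈ superstructure X, star x ∈ superstructure Y
  star_X : star X = Y
  transfer : ∀ (φ : BddFormula) (v : ℕ → ZFSet.{u}), (∀ i, v i ∈ superstructure X) →
    (φ.Realize (superstructure X) v ↔ φ.Realize (superstructure Y) (fun i => star (v i)))
  proper : ∀ A : ZFSet.{u}, A ⊆ X → {x | x ∈ A}.Infinite → ∃ y ∈ star A, ∀ a ∈ A, y ≠ star a

namespace NonstandardUniverse

variable (U : NonstandardUniverse.{u})

/-- `x` is a set, as opposed to an individual, of the standard superstructure. -/
def IsStdSet (x : ZFSet.{u}) : Prop := x ∈ superstructure U.X ∧ x ∉ U.X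

/-- Internal objects: the elements of the nonstandard extensions `*a` of standard sets. -/
def IsInternal (x : ZFSet.{u}) : Prop := ∃ a, U.IsStdSet a ∧ x ∈ U.star a

/-- Internal sets: internal objects that are not individuals. -/
def IsInternalSet (x : ZFSet.{u}) : Prop := U.IsInternal x ∧ x ∉ U.Y

/-- `κ⁺`-saturation: every family of at most `κ` internal sets with the finite intersection
property has nonempty intersection. -/
def IsSuccSaturated (κ : Cardinal.{u}) : Prop :=
  ∀ F : Set ZFSet.{u}, (∀ x ∈ F, U.IsInternalSet x) → #F ≤ Cardinal.lift.{u + 1} κ →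
    (∀ G : Set ZFSet.{u}, G ⊆ F → G.Finite → ∃ z ∈ superstructure U.Y, ∀ x ∈ G, z ∈ x) →
    ∃ z ∈ superstructure U.Y, ∀ x ∈ F, z ∈ x

/-- Hyperfinite sets: the elements of `*D`, where `D` is a standard set of finite sets. -/
def IsHyperfinite (x : ZFSet.{u}) : Prop :=
  ∃ D, U.IsStdSet D ∧ (∀ d ∈ D, d ∉ U.X ∧ {y | y ∈ d}.Finite) ∧ x ∈ U.star D

end NonstandardUniverse

/-! # Set-theoretic coding of tuples, relations, operations and algebras -/

/-- The `n`-tuple `⟨v₀, …, vₙ₋₁⟩`, as an iterated ordered pair. -/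
def tuple : {n : ℕ} → (Fin n → ZFSet.{u}) → ZFSet.{u}
  | 0, _ => ∅
  | _ + 1, v => ZFSet.pair (v 0) (tuple (fun i => v i.succ))

/-- The cartesian power `Sⁿ`, i.e. the set of `n`-tuples of elements of `S`. -/
def cartPower (S : ZFSet.{u}) : ℕ → ZFSet.{u}
  | 0 => {∅}
  | n + 1 => ZFSet.prod S (cartPower S n)

/-- The value `f(x)` of a set-theoretic function `f` at a point `x` of its domain. -/
def app (f x : ZFSet.{u}) : ZFSet.{u} := Classical.epsilon (fun y => ZFSet.pair x y ∈ f)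

/-- `c` identifies the type `B` with a set, namely `ZFSet.range c`, of the superstructure
`V(X)`. -/
structure IsCoding (X : ZFSet.{u}) {B : Type u} (c : B → ZFSet.{u}) : Prop where
  injective : Function.Injective c
  mem_stage : ∃ n, ∀ b, c b ∈ stage X n

/-- The binary relation `W` on `B`, seen as a set of ordered pairs through `c`. -/
def relCode {B : Type u} (c : B → ZFSet.{u}) (W : Set (B × B)) : ZFSet.{u} :=
  ZFSet.range (fun p : W => ZFSet.pair (c p.1.1) (c p.1.2))

/-- The `n`-ary operation `g` on `B`, seen as a set-theoretic function through `c`. -/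
def opCode {B : Type u} (c : B → ZFSet.{u}) {n : ℕ} (g : (Fin n → B) → B) : ZFSet.{u} :=
  ZFSet.range (fun a : Fin n → B => ZFSet.pair (tuple (fun i => c (a i))) (c (g a)))

section Algebras

variable (L : FirstOrder.Language.{s, t}) [Finite (Σ n, L.Functions n)]

/-- The algebra `⟨S, θ⟩` with underlying set `S` in which the function symbol `f` of the finite
signature is interpreted by the set-theoretic function `F f`: the ordered pair of `S` and of the
tuple of all interpretations, in a fixed enumeration of the signature. -/
def algebraCode (S : ZFSet.{u}) (F : (Σ n, L.Functions n) → ZFSet.{u}) : ZFSet.{u} :=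
  ZFSet.pair S (tuple (fun k => F ((Finite.equivFin (Σ n, L.Functions n)).symm k)))

/-- The algebra `B`, seen as a set through `c`. -/
def structureCode (B : Type u) [L.Structure B] (c : B → ZFSet.{u}) : ZFSet.{u} :=
  algebraCode L (ZFSet.range c)
    (fun f => opCode c (FirstOrder.Language.Structure.funMap (M := B) f.2))

/-- The element `K` of the standard superstructure is a set of algebras representing the class `𝒦`
in it: every element of `K` is (a copy of) a member of `𝒦` and every member of `𝒦` has a copy
in `K`. -/
structure Represents (U : NonstandardUniverse.{u}) (K : ZFSet.{u})
    (𝒦 : Set (CategoryTheory.Bundled.{u} L.Structure)) : Prop where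
  mem : K ∈ superstructure U.X
  sound : ∀ k ∈ K, ∃ B ∈ 𝒦, ∃ c : B → ZFSet.{u}, IsCoding U.X c ∧ k = structureCode L B c
  complete : ∀ B ∈ 𝒦, ∃ c : B → ZFSet.{u}, IsCoding U.X c ∧ structureCode L B c ∈ K

/-- `⟨H, F⟩` is a hyperfinite algebra: `H` is a hyperfinite set and every function symbol `f` is
interpreted by an internal operation `F f` on `H`. -/
structure IsHyperfiniteAlgebra (U : NonstandardUniverse.{u}) (H : ZFSet.{u})
    (F : (Σ n, L.Functions n) → ZFSet.{u}) : Prop where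
  hyperfinite : U.IsHyperfinite H
  internal : ∀ f, U.IsInternal (F f)
  isFunc : ∀ f : (Σ n, L.Functions n), ZFSet.IsFunc (cartPower H f.1) H (F f)

end Algebras

/-! # Uniformly locally compact algebras and their finite approximations -/

/-- Every section `W(x) = {y | (x, y) ∈ W}` of `W` is relatively compact. -/
def RelCompactSections {A : Type u} [UniformSpace A] (W : Set (A × A)) : Prop :=
  ∀ x : A, IsCompact (closure (UniformSpace.ball x W))

/-- A uniformly locally compact algebra: a Hausdorff uniform space in which some entourage has
relatively compact sections, with continuous operations. -/
structure IsUniformlyLocallyCompactAlgebra (L : FirstOrder.Language.{s, t}) (A : Type u)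
    [UniformSpace A] [L.Structure A] : Prop where
  t2 : T2Space A
  exists_relCompact : ∃ W ∈ 𝓤 A, RelCompactSections W
  continuous_funMap : ∀ {n : ℕ} (g : L.Functions n),
    Continuous (fun a : Fin n → A => FirstOrder.Language.Structure.funMap g a)

/-- `⟨B, j⟩` is a `(C, W)`-approximation of `A`: `j(B)` is a `(C, W)`-grid and `j` is a
`(C, W)`-homomorphism. -/
structure IsApproximation (L : FirstOrder.Language.{s, t}) {A : Type u} [L.Structure A]
    (C : Set A) (W : Set (A × A)) {B : Type w} [L.Structure B] (j : B → A) : Prop where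
  grid : ∀ x ∈ C, ∃ b : B, (x, j b) ∈ W
  hom : ∀ {n : ℕ} (g : L.Functions n) (b : Fin n → B), (∀ i, j (b i) ∈ C) →
    FirstOrder.Language.Structure.funMap g (fun i => j (b i)) ∈ C →
    (FirstOrder.Language.Structure.funMap g (fun i => j (b i)),
      j (FirstOrder.Language.Structure.funMap g b)) ∈ W

/-- `A` is approximable by finite `𝒦`-algebras. -/
def IsApproximableBy (L : FirstOrder.Language.{s, t}) (A : Type u) [UniformSpace A]
    [L.Structure A] (𝒦 : Set (CategoryTheory.Bundled.{u} L.Structure)) : Prop :=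
  ∀ C : Set A, IsCompact C → ∀ W ∈ 𝓤 A, RelCompactSections W →
    ∃ B ∈ 𝒦, ∃ j : B → A, IsApproximation L C W j

/-- `κ` is an upper bound for the weight of the topology: some base has at most `κ` members. -/
def TopologyWeightLE (A : Type u) [TopologicalSpace A] (κ : Cardinal.{u}) : Prop :=
  ∃ 𝓑 : Set (Set A), TopologicalSpace.IsTopologicalBasis 𝓑 ∧ #𝓑 ≤ κ

/-- `κ` is an upper bound for the weight of the uniformity: some base has at most `κ` members. -/
def UniformityWeightLE (A : Type u) [UniformSpace A] (κ : Cardinal.{u}) : Prop :=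
  ∃ 𝓑 : Set (Set (A × A)), (𝓤 A).HasBasis (fun W => W ∈ 𝓑) id ∧ #𝓑 ≤ κ

/-! # Hyperfinite approximations -/

section Hyperfinite

variable (U : NonstandardUniverse.{u}) {A : Type u} [UniformSpace A] (c : A → ZFSet.{u})

/-- `x ≈ y` for `x, y ∈ *A`: `⟨x, y⟩ ∈ *W` for every entourage `W`. Here `A` is a set of the
standard superstructure through `c`. -/
def InfClose (x y : ZFSet.{u}) : Prop :=
  ∀ W ∈ 𝓤 A, ZFSet.pair x y ∈ U.star (relCode c W)

/-- `x ∈ *A` is nearstandard: it is infinitely close to some `a ∈ A`. -/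
def IsNearstandard (x : ZFSet.{u}) : Prop :=
  x ∈ U.star (ZFSet.range c) ∧ ∃ a : A, InfClose U c x (U.star (c a))

/-- The pair of the hyperfinite algebra `⟨H, F⟩` and the internal map `j : H → *A` is a hyperfinite
approximation of the algebra `A`. -/
structure IsHyperfiniteApproximation (L : FirstOrder.Language.{s, t}) [L.Structure A]
    (H : ZFSet.{u}) (F : (Σ n, L.Functions n) → ZFSet.{u}) (j : ZFSet.{u}) : Prop where
  internal : U.IsInternal j
  isFunc : ZFSet.IsFunc H (U.star (ZFSet.range c)) j
  dense : ∀ a : A, ∃ b ∈ H, InfClose U c (app j b) (U.star (c a))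
  hom : ∀ {n : ℕ} (g : L.Functions n) (b : Fin n → ZFSet.{u}), (∀ i, b i ∈ H) →
    (∀ i, IsNearstandard U c (app j (b i))) →
    InfClose U c (app j (app (F ⟨n, g⟩) (tuple b)))
      (app (U.star (opCode c (FirstOrder.Language.Structure.funMap (M := A) g)))
        (tuple (fun i => app j (b i))))

end Hyperfinite

end

/-! Forward direction. Call a pair of a compact set `C` and an entourage `W` with relatively compact
sections a scale. Approximability says that at every scale some algebra in `K` has an approximation;
by transfer, every element `⟨D, V⟩` of the extension of the set of scales has one too, with algebra
in `*K` and an internal map. Saturation provides such a `⟨D, V⟩` for which `D` contains all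
nearstandard points and `V` is contained in every `*W` (`exists_star_scale`). This uses local
compactness: finite unions of compact closures of basic open sets are compact, and such closures
form neighbourhoods of all points. An approximation at this scale is a hyperfinite approximation:
standard points lie in `D`, which gives density, and by continuity an operation takes nearstandard
arguments to a nearstandard value, so its value lies in `D` as the definition of an approximation
requires (`IsCodedApproximation.isHyperfiniteApproximation`).

Backward direction. If `C` is compact, every point of `*C` is infinitely close to a point of `C`. A
hyperfinite approximation is therefore a `(*C, *W)`-approximation for all standard `C` and `W`
(`IsHyperfiniteApproximation.isCodedApproximation`), and the statement that some approximation
exists transfers back.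

Transfer is available only for explicit bounded formulas, so the existence of an approximation is
written as one formula and evaluated in both superstructures. Its quantifiers need bounds: the
algebra ranges over `K`, the operations over a stage `V_N(X)`, the map over a standard set of maps.
Formulas see only those elements of an object that belong to the superstructure, so atoms look empty
to them; hence the recurring conditions that certain objects are not atoms. Finally, an element of
`*K` must be decoded as a carrier with operations (`star_exists_isAlgebraIn`). This works because
the signature and the arities are finite in the standard sense. -/

noncomputable section

/-! ### Stages of the superstructure, tuples and function values -/

section Superstructure

variable {X : ZFSet.{u}}

theorem stage_mono {m n : ℕ} (h : m ≤ n) : stage X m ⊆ stage X n := by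
  induction h with
  | refl => exact fun _ h => h
  | step _ ih => exact fun _ hx => ZFSet.mem_union.2 (Or.inl (ih hx))

theorem mem_stage_succ_of_subset {x : ZFSet.{u}} {n : ℕ} (h : x ⊆ stage X n) :
    x ∈ stage X (n + 1) :=
  ZFSet.mem_union.2 (Or.inr (ZFSet.mem_powerset.2 h))

theorem mem_superstructure_of_subset {x : ZFSet.{u}} {n : ℕ} (h : x ⊆ stage X n) :
    x ∈ superstructure X :=
  ⟨n + 1, mem_stage_succ_of_subset h⟩

theorem stage_mem_superstructure (n : ℕ) : stage X n ∈ superstructure X :=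
  mem_superstructure_of_subset (n := n) fun _ h => h

theorem subset_stage_of_mem {x : ZFSet.{u}} {n : ℕ} (hx : x ∉ X) (h : x ∈ stage X n) :
    x ⊆ stage X n := by
  induction n with
  | zero => exact absurd h hx
  | succ n ih =>
    rcases ZFSet.mem_union.1 h with h | h
    · exact fun z hz => stage_mono n.le_succ (ih h hz)
    · exact fun z hz => stage_mono n.le_succ (ZFSet.mem_powerset.1 h hz)

theorem empty_mem_superstructure : (∅ : ZFSet.{u}) ∈ superstructure X :=
  mem_superstructure_of_subset (n := 0) (ZFSet.empty_subset _)

theorem IsBaseSet.notMem_of_mem (hX : IsBaseSet X) {x y : ZFSet.{u}} (hy : y ∈ x)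
    (h : y ∈ superstructure X) : x ∉ X :=
  fun hx => hX.atom x hx y hy h

theorem IsBaseSet.notMem_of_forall (hX : IsBaseSet X) {x : ZFSet.{u}}
    (h : ∀ y ∈ x, y ∈ superstructure X) : x ∉ X := by
  intro hx
  rcases ZFSet.eq_empty_or_nonempty x with rfl | ⟨y, hy⟩
  · exact hX.empty_notMem hx
  · exact hX.atom x hx y hy (h y hy)

theorem IsBaseSet.notMem_of_subset (hX : IsBaseSet X) {x : ZFSet.{u}} {n : ℕ}
    (h : x ⊆ stage X n) : x ∉ X :=
  hX.notMem_of_forall fun _ hy => ⟨n, h hy⟩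

theorem mem_superstructure_of_mem {x y : ZFSet.{u}} (hx : x ∈ superstructure X) (hX : x ∉ X)
    (hy : y ∈ x) : y ∈ superstructure X := by
  obtain ⟨n, hn⟩ := hx
  exact ⟨n, subset_stage_of_mem hX hn hy⟩

theorem pair_mem_stage {x y : ZFSet.{u}} {n : ℕ} (hx : x ∈ stage X n) (hy : y ∈ stage X n) :
    ZFSet.pair x y ∈ stage X (n + 2) := by
  refine mem_stage_succ_of_subset fun z hz => ?_
  simp only [ZFSet.pair, ZFSet.mem_pair] at hz
  refine mem_stage_succ_of_subset fun w hw => ?_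
  rcases hz with rfl | rfl
  · rw [ZFSet.mem_singleton] at hw; exact hw ▸ hx
  · rcases ZFSet.mem_pair.1 hw with rfl | rfl <;> assumption

theorem pair_mem_superstructure {x y : ZFSet.{u}} (hx : x ∈ superstructure X)
    (hy : y ∈ superstructure X) : ZFSet.pair x y ∈ superstructure X := by
  obtain ⟨m, hm⟩ := hx
  obtain ⟨n, hn⟩ := hy
  exact ⟨max m n + 2, pair_mem_stage (stage_mono (le_max_left _ _) hm)
    (stage_mono (le_max_right _ _) hn)⟩

theorem singleton_mem_superstructure {x : ZFSet.{u}} (hx : x ∈ superstructure X) :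
    {x} ∈ superstructure X := by
  obtain ⟨n, hn⟩ := hx
  exact mem_superstructure_of_subset (n := n) fun z hz => by
    rw [ZFSet.mem_singleton] at hz; exact hz ▸ hn

theorem doubleton_mem_superstructure {x y : ZFSet.{u}} (hx : x ∈ superstructure X)
    (hy : y ∈ superstructure X) : {x, y} ∈ superstructure X := by
  obtain ⟨m, hm⟩ := hx
  obtain ⟨n, hn⟩ := hy
  refine mem_superstructure_of_subset (n := max m n) fun z hz => ?_
  rcases ZFSet.mem_pair.1 hz with rfl | rfl
  exacts [stage_mono (le_max_left _ _) hm, stage_mono (le_max_right _ _) hn]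

theorem tuple_mem_stage {m n : ℕ} {v : Fin m → ZFSet.{u}} (hv : ∀ i, v i ∈ stage X n) :
    tuple v ∈ stage X (n + 1 + 2 * m) := by
  induction m with
  | zero => exact mem_stage_succ_of_subset (ZFSet.empty_subset _)
  | succ m ih =>
    have h : n ≤ n + 1 + 2 * m := by omega
    exact pair_mem_stage (stage_mono h (hv 0)) (ih fun i => hv i.succ)

theorem tuple_mem_superstructure {m : ℕ} {v : Fin m → ZFSet.{u}}
    (hv : ∀ i, v i ∈ superstructure X) : tuple v ∈ superstructure X := by
  induction m with
  | zero => exact empty_mem_superstructure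
  | succ m ih => exact pair_mem_superstructure (hv 0) (ih fun i => hv i.succ)

theorem prod_subset_stage {x y : ZFSet.{u}} {n : ℕ} (hx : x ⊆ stage X n) (hy : y ⊆ stage X n) :
    ZFSet.prod x y ⊆ stage X (n + 2) := by
  intro z hz
  obtain ⟨a, ha, b, hb, rfl⟩ := ZFSet.mem_prod.1 hz
  exact pair_mem_stage (hx ha) (hy hb)

theorem mem_cartPower {S : ZFSet.{u}} {n : ℕ} {z : ZFSet.{u}} :
    z ∈ cartPower S n ↔ ∃ v : Fin n → ZFSet.{u}, (∀ i, v i ∈ S) ∧ z = tuple v := by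
  induction n generalizing z with
  | zero => simp [cartPower, tuple]
  | succ n ih =>
    simp only [cartPower, ZFSet.mem_prod, ih]
    constructor
    · rintro ⟨a, ha, b, ⟨v, hv, rfl⟩, rfl⟩
      exact ⟨Fin.cons a v, Fin.cases ha hv, by simp [tuple]⟩
    · rintro ⟨v, hv, rfl⟩
      exact ⟨v 0, hv 0, _, ⟨fun i => v i.succ, fun i => hv _, rfl⟩, rfl⟩

theorem tuple_mem_cartPower {S : ZFSet.{u}} {n : ℕ} {v : Fin n → ZFSet.{u}} :
    tuple v ∈ cartPower S n ↔ ∀ i, v i ∈ S := by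
  induction n with
  | zero => simp [cartPower, tuple]
  | succ n ih => simp [cartPower, tuple, ih, Fin.forall_fin_succ]

theorem tuple_injective {n : ℕ} : Function.Injective (tuple : (Fin n → ZFSet.{u}) → ZFSet.{u}) := by
  induction n with
  | zero => intro a b _; exact Subsingleton.elim _ _
  | succ n ih =>
    intro a b h
    obtain ⟨h1, h2⟩ := ZFSet.pair_inj.1 h
    have := ih h2
    exact funext (Fin.cases h1 fun i => congrFun this i)

theorem cartPower_subset_stage {x : ZFSet.{u}} {n : ℕ} (hx : x ⊆ stage X n) (m : ℕ) :
    cartPower x m ⊆ stage X (n + 1 + 2 * m) := by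
  intro z hz
  obtain ⟨v, hv, rfl⟩ := mem_cartPower.1 hz
  exact tuple_mem_stage fun i => hx (hv i)

theorem cartPower_mono {S T : ZFSet.{u}} (h : S ⊆ T) (n : ℕ) : cartPower S n ⊆ cartPower T n := by
  intro z hz
  obtain ⟨v, hv, rfl⟩ := mem_cartPower.1 hz
  exact tuple_mem_cartPower.2 fun i => h (hv i)

/-- The value of a set-theoretic function is determined by any pair in it. -/
theorem app_eq {x y f a b : ZFSet.{u}} (hf : ZFSet.IsFunc x y f) (h : ZFSet.pair a b ∈ f) :
    app f a = b :=
  (hf.2 a (ZFSet.pair_mem_prod.1 (hf.1 h)).1).unique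
    (Classical.epsilon_spec (p := fun y => ZFSet.pair a y ∈ f) ⟨b, h⟩) h

theorem pair_app_mem {x y f a : ZFSet.{u}} (hf : ZFSet.IsFunc x y f) (ha : a ∈ x) :
    ZFSet.pair a (app f a) ∈ f :=
  Classical.epsilon_spec (p := fun y => ZFSet.pair a y ∈ f) (hf.2 a ha).exists

theorem app_mem {x y f a : ZFSet.{u}} (hf : ZFSet.IsFunc x y f) (ha : a ∈ x) : app f a ∈ y :=
  (ZFSet.pair_mem_prod.1 (hf.1 (pair_app_mem hf ha))).2

end Superstructure

/-! ### Bounded formulas for elementary set-theoretic notions -/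

section Formulas

/-- `x` is the component with index `k` of the tuple `y` of elements of `V(X)`. -/
def IsComponent {X : ZFSet.{u}} (x : superstructure X) : ℕ → superstructure X → Prop
  | 0, y => ∃ z : superstructure X, y.1 = ZFSet.pair x.1 z.1
  | k + 1, y => ∃ a z : superstructure X, y.1 = ZFSet.pair a.1 z.1 ∧ IsComponent x k z

/-- A tuple ends in `∅`, so even its last component is the first entry of a pair and needs no
separate case. -/
theorem isComponent_tuple {X : ZFSet.{u}} {x y : superstructure X} {n : ℕ}
    {v : Fin n → superstructure X} (hy : y.1 = tuple fun i => (v i).1) (k : Fin n) :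
    IsComponent x k y ↔ x = v k := by
  induction n generalizing y with
  | zero => exact k.elim0
  | succ n ih =>
    have hz : tuple (fun i : Fin n => (v i.succ).1) ∈ superstructure X :=
      tuple_mem_superstructure fun i => (v i.succ).2
    refine Fin.cases ?_ (fun k => ?_) k
    · simp only [Fin.val_zero, IsComponent, hy, tuple, ZFSet.pair_inj, Subtype.ext_iff]
      exact ⟨fun ⟨_, h, _⟩ => h.symm, fun h => ⟨⟨_, hz⟩, h.symm, rfl⟩⟩
    · simp only [Fin.val_succ, IsComponent, hy, tuple, ZFSet.pair_inj]
      rw [← ih (y := ⟨_, hz⟩) (v := fun i => v i.succ) rfl k]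
      constructor
      · rintro ⟨a, z, ⟨_, h⟩, h'⟩
        rwa [← Subtype.ext (a1 := z) (a2 := ⟨_, hz⟩) h.symm]
      · intro h; exact ⟨_, ⟨_, hz⟩, ⟨rfl, rfl⟩, h⟩

namespace BddFormula

variable {X : ZFSet.{u}}

/-- Truth of a bounded formula in `V(X)`. -/
def Holds (φ : BddFormula) (v : ℕ → superstructure X) : Prop :=
  φ.Realize (superstructure X) (fun i => (v i : ZFSet.{u}))

variable {v : ℕ → superstructure X} {φ ψ : BddFormula} {i j : ℕ}

@[simp] theorem holds_mem : (mem i j).Holds v ↔ (v i).1 ∈ (v j).1 := Iff.rfl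

@[simp] theorem holds_eq : (eq i j).Holds v ↔ v i = v j := Subtype.ext_iff.symm

@[simp] theorem holds_neg : (neg φ).Holds v ↔ ¬ φ.Holds v := Iff.rfl

@[simp] theorem holds_and : (and φ ψ).Holds v ↔ φ.Holds v ∧ ψ.Holds v := Iff.rfl

@[simp] theorem holds_ball : (ball i j φ).Holds v ↔
    ∀ z : superstructure X, z.1 ∈ (v j).1 → φ.Holds (Function.update v i z) := by
  have h : ∀ z : superstructure X, (fun k => (Function.update v i z k : ZFSet.{u})) =
      Function.update (fun k => (v k : ZFSet.{u})) i z := by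
    intro z; ext1 k; by_cases hk : k = i
    · subst hk; simp
    · simp [hk]
  simp only [Holds, Realize, Subtype.forall, h]

/-- Disjunction. -/
def or (φ ψ : BddFormula) : BddFormula := neg (and (neg φ) (neg ψ))

/-- Implication. -/
def imp (φ ψ : BddFormula) : BddFormula := neg (and φ (neg ψ))

/-- `(∃ vᵢ ∈ vⱼ) φ`. -/
def bex (i j : ℕ) (φ : BddFormula) : BddFormula := neg (ball i j (neg φ))

@[simp] theorem holds_or : (or φ ψ).Holds v ↔ φ.Holds v ∨ ψ.Holds v := by
  simp only [or, holds_neg, holds_and]; tauto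

@[simp] theorem holds_imp : (imp φ ψ).Holds v ↔ (φ.Holds v → ψ.Holds v) := by
  simp only [imp, holds_neg, holds_and]; tauto

@[simp] theorem holds_bex : (bex i j φ).Holds v ↔
    ∃ z : superstructure X, z.1 ∈ (v j).1 ∧ φ.Holds (Function.update v i z) := by
  simp [bex]

/-- The conjunction of `n` formulas. -/
def all : (n : ℕ) → (Fin n → BddFormula) → BddFormula
  | 0, _ => eq 0 0
  | n + 1, φ => and (φ 0) (all n fun i => φ i.succ)

@[simp] theorem holds_all {n : ℕ} {φ : Fin n → BddFormula} :
    (all n φ).Holds v ↔ ∀ i, (φ i).Holds v := by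
  induction n with
  | zero => simp [all]
  | succ n ih => simp [all, ih, Fin.forall_fin_succ]

/-- `v_w = {v_x, v_y}`. -/
def isDoubleton (w x y : ℕ) : BddFormula :=
  -- The index `w + x + y + 1` exceeds all indices in use and serves as a fresh bound variable. The
  -- same device is used for the formulas below.
  and (mem x w) (and (mem y w) (ball (w + x + y + 1) w (or (eq (w + x + y + 1) x)
    (eq (w + x + y + 1) y))))

/-- `v_p = ⟨v_x, v_y⟩`. -/
def isPair (p x y : ℕ) : BddFormula :=
  and (bex (p + x + y + 1) p (isDoubleton (p + x + y + 1) x x))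
    (and (bex (p + x + y + 1) p (isDoubleton (p + x + y + 1) x y))
      (ball (p + x + y + 1) p
        (or (isDoubleton (p + x + y + 1) x x) (isDoubleton (p + x + y + 1) x y))))

/-- `⟨v_x, v_y⟩ ∈ v_r`. -/
def pairMem (x y r : ℕ) : BddFormula := bex (x + y + r + 1) r (isPair (x + y + r + 1) x y)

/-- `∃ v_x v_y, v_p = ⟨v_x, v_y⟩ ∧ φ`. -/
def exPair (p x y : ℕ) (φ : BddFormula) : BddFormula :=
  -- The entries of a pair are reached through its element `{v_x, v_y}`. The outer quantifier stores
  -- that element in the slot `y`, and the innermost one overwrites the slot with the second entry.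
  bex y p (bex x y (bex y y (and (isPair p x y) φ)))

/-- `∀ v_x v_y, v_p = ⟨v_x, v_y⟩ → φ`. -/
def allPair (p x y : ℕ) (φ : BddFormula) : BddFormula := neg (exPair p x y (neg φ))

/-- `v_t` is an `n`-tuple of elements of `v_s`, where `v_e = ∅`. -/
def tupleMem (s e : ℕ) : ℕ → ℕ → BddFormula
  | 0, t => eq t e
  | n + 1, t => exPair t (t + s + e + 1) (t + s + e + 2)
      (and (mem (t + s + e + 1) s) (tupleMem s e n (t + s + e + 2)))

/-- `v_t` and `v_t'` are `n`-tuples with components related by `v_r`, where `v_e = ∅`. -/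
def tupleRel (r e : ℕ) : ℕ → ℕ → ℕ → BddFormula
  | 0, t, t' => and (eq t e) (eq t' e)
  | n + 1, t, t' =>
      exPair t (t + t' + r + e + 1) (t + t' + r + e + 2)
        (exPair t' (t + t' + r + e + 3) (t + t' + r + e + 4)
          (and (pairMem (t + t' + r + e + 1) (t + t' + r + e + 3) r)
            (tupleRel r e n (t + t' + r + e + 2) (t + t' + r + e + 4))))

/-- `v_x` is the component with index `k` of the tuple `v_t`. -/
def isComponent (x : ℕ) : ℕ → ℕ → BddFormula
  | 0, t => exPair t (t + x + 1) (t + x + 2) (eq x (t + x + 1))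
  | k + 1, t => exPair t (t + x + 1) (t + x + 2) (isComponent x k (t + x + 2))

section Atoms

variable [hX : Fact (IsBaseSet X)]

@[simp] theorem holds_isDoubleton {w x y : ℕ} :
    (isDoubleton w x y).Holds v ↔ (v w).1 = {(v x).1, (v y).1} := by
  have h1 : w ≠ w + x + y + 1 := by omega
  have h2 : x ≠ w + x + y + 1 := by omega
  have h3 : y ≠ w + x + y + 1 := by omega
  simp only [isDoubleton, holds_and, holds_mem, holds_ball, holds_or, holds_eq,
    Function.update_self, Function.update_of_ne h2, Function.update_of_ne h3]
  constructor
  · rintro ⟨hx, hy, h⟩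
    -- Having an element in `V(X)`, the value of `w` is not an atom, so all its elements are in
    -- `V(X)` and the bounded quantifier reaches each of them.
    have hw := hX.out.notMem_of_mem hx (v x).2
    ext z
    rw [ZFSet.mem_pair]
    constructor
    · intro hz
      have := h ⟨z, mem_superstructure_of_mem (v w).2 hw hz⟩ hz
      simpa [Subtype.ext_iff] using this
    · rintro (rfl | rfl) <;> assumption
  · intro h
    rw [h]
    simp [Subtype.ext_iff]

@[simp] theorem holds_isPair {p x y : ℕ} :
    (isPair p x y).Holds v ↔ (v p).1 = ZFSet.pair (v x).1 (v y).1 := by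
  have h2 : x ≠ p + x + y + 1 := by omega
  have h3 : y ≠ p + x + y + 1 := by omega
  simp only [isPair, holds_and, holds_ball, holds_bex, holds_or, holds_isDoubleton,
    Function.update_self, Function.update_of_ne h2, Function.update_of_ne h3]
  constructor
  · rintro ⟨⟨a, ha, ha'⟩, ⟨b, hb, hb'⟩, h⟩
    have hw := hX.out.notMem_of_mem ha a.2
    ext z
    rw [ZFSet.pair_eq_singleton] at ha'
    simp only [ZFSet.pair, ZFSet.mem_pair]
    constructor
    · intro hz
      simpa using h ⟨z, mem_superstructure_of_mem (v p).2 hw hz⟩ hz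
    · rintro (rfl | rfl)
      exacts [ha' ▸ ha, hb' ▸ hb]
  · intro h
    rw [h]
    refine ⟨⟨⟨_, singleton_mem_superstructure (v x).2⟩, by simp [ZFSet.pair], by simp⟩,
      ⟨⟨_, doubleton_mem_superstructure (v x).2 (v y).2⟩, by simp [ZFSet.pair], rfl⟩, ?_⟩
    simp [ZFSet.pair]

@[simp] theorem holds_pairMem {x y r : ℕ} :
    (pairMem x y r).Holds v ↔ ZFSet.pair (v x).1 (v y).1 ∈ (v r).1 := by
  have h2 : x ≠ x + y + r + 1 := by omega
  have h3 : y ≠ x + y + r + 1 := by omega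
  simp only [pairMem, holds_bex, holds_isPair, Function.update_self, Function.update_of_ne h2,
    Function.update_of_ne h3]
  constructor
  · rintro ⟨z, hz, h⟩; exact h ▸ hz
  · intro h; exact ⟨⟨_, pair_mem_superstructure (v x).2 (v y).2⟩, h, rfl⟩

@[simp] theorem holds_exPair {p x y : ℕ} (hpx : p ≠ x) (hpy : p ≠ y) (hxy : x ≠ y) :
    (exPair p x y φ).Holds v ↔ ∃ a b : superstructure X, (v p).1 = ZFSet.pair a.1 b.1 ∧
      φ.Holds (Function.update (Function.update v x a) y b) := by
  have key : ∀ w a b : superstructure X,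
      Function.update (Function.update (Function.update v y w) x a) y b =
        Function.update (Function.update v x a) y b := by
    intro w a b
    rw [Function.update_comm hxy.symm, Function.update_idem]
  simp only [exPair, holds_bex, holds_and, holds_isPair, Function.update_self, key,
    Function.update_of_ne hpx, Function.update_of_ne hpy, Function.update_of_ne hxy,
    Function.update_of_ne hxy.symm]
  constructor
  · rintro ⟨w, -, a, -, b, -, h⟩; exact ⟨a, b, h⟩
  · rintro ⟨a, b, h⟩
    exact ⟨⟨_, doubleton_mem_superstructure a.2 b.2⟩, by rw [h.1]; simp [ZFSet.pair], a, by simp,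
      b, by simp, h⟩

@[simp] theorem holds_allPair {p x y : ℕ} (hpx : p ≠ x) (hpy : p ≠ y) (hxy : x ≠ y) :
    (allPair p x y φ).Holds v ↔ ∀ a b : superstructure X, (v p).1 = ZFSet.pair a.1 b.1 →
      φ.Holds (Function.update (Function.update v x a) y b) := by
  simp only [allPair, holds_neg, holds_exPair hpx hpy hxy, not_exists, not_and, not_not]

/-- The variable `e` replaces a constant symbol for `∅`. The length `n` is a number of the
metatheory over which the formula is built recursively, so it has the same meaning in both
superstructures. -/
theorem holds_tupleMem {s e : ℕ} (he : (v e).1 = ∅) {n t : ℕ} :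
    (tupleMem s e n t).Holds v ↔ ∃ f : Fin n → superstructure X, (∀ i, (f i).1 ∈ (v s).1) ∧
      (v t).1 = tuple fun i => (f i).1 := by
  induction n generalizing t v with
  | zero => simp [tupleMem, tuple, Subtype.ext_iff, he]
  | succ n ih =>
    have h1 : s ≠ t + s + e + 1 := by omega
    have h2 : s ≠ t + s + e + 2 := by omega
    have h3 : e ≠ t + s + e + 1 := by omega
    have h4 : e ≠ t + s + e + 2 := by omega
    have h5 : t + s + e + 1 ≠ t + s + e + 2 := by omega
    rw [tupleMem, holds_exPair (by omega) (by omega) h5]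
    simp only [holds_and, holds_mem, Function.update_of_ne h1, Function.update_of_ne h2,
      Function.update_self, Function.update_of_ne h5]
    constructor
    · rintro ⟨a, b, hab, h, h'⟩
      obtain ⟨f, hf, hf'⟩ := (ih (by simp [h3, h4, he])).1 h'
      simp only [Function.update_of_ne h1, Function.update_of_ne h2,
        Function.update_self] at hf hf'
      exact ⟨Fin.cons a f, Fin.cases h hf, by rw [hab, hf']; rfl⟩
    · rintro ⟨f, hf, hf'⟩
      refine ⟨f 0, ⟨_, tuple_mem_superstructure fun i => (f i.succ).2⟩, hf', hf 0,
        (ih (by simp [h3, h4, he])).2 ⟨fun i => f i.succ, ?_⟩⟩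
      simpa [Function.update_of_ne h1, Function.update_of_ne h2] using fun i => hf (Fin.succ i)

theorem holds_tupleRel {r e : ℕ} (he : (v e).1 = ∅) {n t t' : ℕ} :
    (tupleRel r e n t t').Holds v ↔ ∃ f g : Fin n → superstructure X,
      (v t).1 = tuple (fun i => (f i).1) ∧ (v t').1 = tuple (fun i => (g i).1) ∧
        ∀ i, ZFSet.pair (f i).1 (g i).1 ∈ (v r).1 := by
  induction n generalizing t t' v with
  | zero => simp [tupleRel, tuple, Subtype.ext_iff, he]
  | succ n ih =>
    set N := t + t' + r + e with hN
    have hr : ∀ k, r ≠ N + (k + 1) := by omega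
    have he' : ∀ k, e ≠ N + (k + 1) := by omega
    have ht' : ∀ k, t' ≠ N + (k + 1) := by omega
    have hne : ∀ k l, k ≠ l → N + k ≠ N + l := by omega
    rw [tupleRel, holds_exPair (by omega) (by omega) (by omega)]
    have hE : ∀ a b c d, (Function.update (Function.update (Function.update (Function.update v
        (N + 1) a) (N + 2) b) (N + 3) c) (N + 4) d e).1 = ∅ := by
      intro a b c d; simp [he', he]
    have hT : ∀ a b, Function.update (Function.update v (N + 1) a) (N + 2) b t' = v t' := by
      intro a b; simp [ht']
    simp only [← hN, holds_exPair (ht' 2) (ht' 3) (hne 3 4 (by decide)), holds_and,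
      holds_pairMem, ih (hE _ _ _ _), hT]
    simp only [Function.update_self, Function.update_of_ne (hr _),
      Function.update_of_ne (hne 1 2 (by decide)), Function.update_of_ne (hne 1 3 (by decide)),
      Function.update_of_ne (hne 1 4 (by decide)), Function.update_of_ne (hne 2 3 (by decide)),
      Function.update_of_ne (hne 2 4 (by decide)), Function.update_of_ne (hne 3 4 (by decide))]
    constructor
    · rintro ⟨a, b, hab, c, d, hcd, h, f, g, hf, hg, hfg⟩
      exact ⟨Fin.cons a f, Fin.cons c g, by rw [hab, hf]; rfl, by rw [hcd, hg]; rfl,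
        Fin.cases h hfg⟩
    · rintro ⟨f, g, hf, hg, hfg⟩
      exact ⟨f 0, ⟨_, tuple_mem_superstructure fun i => (f i.succ).2⟩, hf,
        g 0, ⟨_, tuple_mem_superstructure fun i => (g i.succ).2⟩, hg, hfg 0,
        fun i => f i.succ, fun i => g i.succ, rfl, rfl, fun i => hfg _⟩

theorem holds_isComponent {x k t : ℕ} :
    (isComponent x k t).Holds v ↔ IsComponent (v x) k (v t) := by
  have h1 : x ≠ t + x + 1 := by omega
  have h2 : x ≠ t + x + 2 := by omega
  have h5 : t + x + 1 ≠ t + x + 2 := by omega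
  induction k generalizing t v with
  | zero =>
    rw [isComponent, holds_exPair (by omega) (by omega) h5]
    simp only [holds_eq, Function.update_self, Function.update_of_ne h1, Function.update_of_ne h2,
      Function.update_of_ne h5, IsComponent]
    constructor
    · rintro ⟨a, b, h, rfl⟩; exact ⟨b, h⟩
    · rintro ⟨b, h⟩; exact ⟨_, b, h, rfl⟩
  | succ k ih =>
    rw [isComponent, holds_exPair (by omega) (by omega) h5]
    simp only [ih (t := t + x + 2) (by omega) (by omega) (by omega), Function.update_self,
      Function.update_of_ne h1, Function.update_of_ne h2, IsComponent]

end Atoms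

end BddFormula

end Formulas

/-! ### Elementary consequences of transfer -/

namespace NonstandardUniverse

open BddFormula

variable (U : NonstandardUniverse.{u})

instance : Fact (IsBaseSet U.X) := ⟨U.base_X⟩

instance : Fact (IsBaseSet U.Y) := ⟨U.base_Y⟩

/-- The map `*` as a map between the superstructures. -/
def st (x : superstructure U.X) : superstructure U.Y := ⟨U.star x, U.star_mem _ x.2⟩

@[simp] theorem coe_st (x : superstructure U.X) : (U.st x).1 = U.star x := rfl

theorem holds_iff (φ : BddFormula) (v : ℕ → superstructure U.X) :
    φ.Holds v ↔ φ.Holds fun i => U.st (v i) :=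
  U.transfer φ _ fun i => (v i).2

/-- The assignment with initial values in the list `l`, and `∅` elsewhere. -/
def _root_.assign {X : ZFSet.{u}} (l : List (superstructure X)) (i : ℕ) : superstructure X :=
  l.getD i ⟨∅, empty_mem_superstructure⟩

variable {U} {x y z a b r : ZFSet.{u}}

theorem isStdSet_of_subset {n : ℕ} (h : x ⊆ stage U.X n) : U.IsStdSet x :=
  ⟨mem_superstructure_of_subset h, U.base_X.notMem_of_subset h⟩

theorem isStdSet_stage (n : ℕ) : U.IsStdSet (stage U.X n) := isStdSet_of_subset fun _ h => h

theorem IsStdSet.exists_stage (hx : U.IsStdSet x) : ∃ n, x ⊆ stage U.X n :=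
  let ⟨n, hn⟩ := hx.1
  ⟨n, subset_stage_of_mem hx.2 hn⟩

theorem IsStdSet.mem (hx : U.IsStdSet x) (hy : y ∈ x) : y ∈ superstructure U.X :=
  mem_superstructure_of_mem hx.1 hx.2 hy

theorem IsStdSet.mono (hx : U.IsStdSet x) (hy : y ⊆ x) : U.IsStdSet y :=
  let ⟨_, hn⟩ := hx.exists_stage
  isStdSet_of_subset fun _ hz => hn (hy hz)

theorem star_mem_star (hx : x ∈ superstructure U.X) (hy : y ∈ superstructure U.X) :
    U.star x ∈ U.star y ↔ x ∈ y := by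
  simpa [assign] using (U.holds_iff (.mem 0 1) (assign [⟨x, hx⟩, ⟨y, hy⟩])).symm

theorem star_mem_Y (hx : x ∈ superstructure U.X) : U.star x ∈ U.Y ↔ x ∈ U.X := by
  rw [← U.star_X, star_mem_star (y := U.X) hx (stage_mem_superstructure 0)]

theorem IsStdSet.star_notMem (hx : U.IsStdSet x) : U.star x ∉ U.Y :=
  fun h => hx.2 ((star_mem_Y hx.1).1 h)

/-- Elements of the extension of a standard set belong to `V(Y)`. -/
theorem IsStdSet.star_elem (hx : U.IsStdSet x) (hy : y ∈ U.star x) : y ∈ superstructure U.Y :=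
  mem_superstructure_of_mem (U.star_mem _ hx.1) hx.star_notMem hy

theorem isStdSet_empty : U.IsStdSet (∅ : ZFSet.{u}) :=
  isStdSet_of_subset (n := 0) (ZFSet.empty_subset _)

theorem star_empty : U.star ∅ = ∅ := by
  rw [ZFSet.eq_empty]
  intro y hy
  have h := (U.holds_iff (.ball 1 0 (.neg (.eq 1 1))) (assign [⟨∅, isStdSet_empty.1⟩])).1
    (by simp [assign])
  simp only [holds_ball] at h
  simpa using h ⟨y, isStdSet_empty.star_elem hy⟩ hy

theorem star_subset (hx : U.IsStdSet x) (hy : y ∈ superstructure U.X) (h : x ⊆ y) :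
    U.star x ⊆ U.star y := by
  have := (U.holds_iff (.ball 2 0 (.mem 2 1)) (assign [⟨x, hx.1⟩, ⟨y, hy⟩])).1
    (by simpa [assign] using fun a _ ha => h ha)
  intro z hz
  simpa [assign] using holds_ball.1 this ⟨z, hx.star_elem hz⟩ hz

theorem star_union_subset (hx : U.IsStdSet x) (hy : y ∈ superstructure U.X)
    (hz : z ∈ superstructure U.X) (h : x ⊆ y ∪ z) : U.star x ⊆ U.star y ∪ U.star z := by
  have := (U.holds_iff (.ball 3 0 (.or (.mem 3 1) (.mem 3 2)))
    (assign [⟨x, hx.1⟩, ⟨y, hy⟩, ⟨z, hz⟩])).1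
    (by simpa [assign] using fun a _ ha => ZFSet.mem_union.1 (h ha))
  intro w hw
  rw [ZFSet.mem_union]
  simpa [assign] using holds_ball.1 this ⟨w, hx.star_elem hw⟩ hw

theorem star_pair (hx : x ∈ superstructure U.X) (hy : y ∈ superstructure U.X) :
    U.star (ZFSet.pair x y) = ZFSet.pair (U.star x) (U.star y) := by
  simpa [assign] using (U.holds_iff (.isPair 2 0 1)
    (assign [⟨x, hx⟩, ⟨y, hy⟩, ⟨_, pair_mem_superstructure hx hy⟩])).1 (by simp [assign])

theorem star_tuple {n : ℕ} {v : Fin n → ZFSet.{u}} (hv : ∀ i, v i ∈ superstructure U.X) :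
    U.star (tuple v) = tuple fun i => U.star (v i) := by
  induction n with
  | zero => exact star_empty
  | succ n ih =>
    rw [tuple, star_pair (hv 0) (tuple_mem_superstructure fun i => hv i.succ),
      ih fun i => hv i.succ, tuple]

theorem IsStdSet.prod (hx : U.IsStdSet x) (hy : U.IsStdSet y) : U.IsStdSet (ZFSet.prod x y) := by
  obtain ⟨m, hm⟩ := hx.exists_stage
  obtain ⟨n, hn⟩ := hy.exists_stage
  exact isStdSet_of_subset (prod_subset_stage (n := max m n)
    (fun _ h => stage_mono (le_max_left _ _) (hm h))
    (fun _ h => stage_mono (le_max_right _ _) (hn h)))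

theorem IsStdSet.cartPower (hx : U.IsStdSet x) (n : ℕ) : U.IsStdSet (cartPower x n) := by
  obtain ⟨m, hm⟩ := hx.exists_stage
  exact isStdSet_of_subset (cartPower_subset_stage hm n)

theorem star_prod (hx : U.IsStdSet x) (hy : U.IsStdSet y) :
    U.star (ZFSet.prod x y) = ZFSet.prod (U.star x) (U.star y) := by
  have hP := hx.prod hy
  have h1 := (U.holds_iff (.ball 3 2 (.exPair 3 4 5 (.and (.mem 4 0) (.mem 5 1))))
    (assign [⟨x, hx.1⟩, ⟨y, hy.1⟩, ⟨_, hP.1⟩])).1 (by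
      simp only [holds_ball, holds_exPair, ne_eq, Nat.reduceEqDiff, not_false_eq_true]
      rintro ⟨p, hp⟩ h
      obtain ⟨a, ha, b, hb, rfl⟩ := ZFSet.mem_prod.1 h
      exact ⟨⟨a, hx.mem ha⟩, ⟨b, hy.mem hb⟩, by simp, by simp [assign, ha, hb]⟩)
  have h2 := (U.holds_iff (.ball 3 0 (.ball 4 1 (.pairMem 3 4 2)))
    (assign [⟨x, hx.1⟩, ⟨y, hy.1⟩, ⟨_, hP.1⟩])).1 (by
      simp only [holds_ball, holds_pairMem]
      rintro ⟨a, ha'⟩ ha ⟨b, hb'⟩ hb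
      simp only [assign] at ha hb
      simpa [assign] using ⟨ha, hb⟩)
  simp only [holds_ball, holds_exPair, ne_eq, Nat.reduceEqDiff, not_false_eq_true,
    holds_pairMem] at h1 h2
  ext p
  rw [ZFSet.mem_prod]
  constructor
  · intro hp
    obtain ⟨a, b, hab, h⟩ := h1 ⟨p, hP.star_elem hp⟩ hp
    simp [assign] at hab h
    exact ⟨a, h.1, b, h.2, hab⟩
  · rintro ⟨a, ha, b, hb, rfl⟩
    simpa [assign] using h2 ⟨a, hx.star_elem ha⟩ ha ⟨b, hy.star_elem hb⟩ hb

theorem star_cartPower (hx : U.IsStdSet x) (n : ℕ) :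
    U.star (cartPower x n) = cartPower (U.star x) n := by
  induction n with
  | zero =>
    have h0 : ({∅} : ZFSet.{u}) ∈ superstructure U.X := (hx.cartPower 0).1
    have := (U.holds_iff (.isDoubleton 1 0 0) (assign [⟨∅, isStdSet_empty.1⟩, ⟨_, h0⟩])).1
      (by simp [assign])
    simpa [assign, star_empty, cartPower] using this
  | succ n ih => rw [cartPower, star_prod hx (hx.cartPower n), ih, cartPower]

theorem star_isFunc (hx : U.IsStdSet x) (hy : U.IsStdSet y) {f : ZFSet.{u}}
    (hf : ZFSet.IsFunc x y f) : ZFSet.IsFunc (U.star x) (U.star y) (U.star f) := by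
  have hfs : U.IsStdSet f := (hx.prod hy).mono hf.1
  refine ⟨star_prod hx hy ▸ star_subset hfs (hx.prod hy).1 hf.1, fun a ha => ?_⟩
  have h := (U.holds_iff (.ball 3 0 (.bex 4 1 (.and (.pairMem 3 4 2)
    (.ball 5 1 (.imp (.pairMem 3 5 2) (.eq 5 4))))))
    (assign [⟨x, hx.1⟩, ⟨y, hy.1⟩, ⟨f, hfs.1⟩])).1 (by
      simp only [holds_ball, holds_bex, holds_and, holds_imp, holds_pairMem, holds_eq]
      rintro ⟨a, ha'⟩ ha
      refine ⟨⟨app f a, hy.mem (app_mem hf ha)⟩, app_mem hf ha, pair_app_mem hf ha, ?_⟩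
      rintro ⟨b, hb'⟩ hb h
      exact Subtype.ext (app_eq hf h).symm)
  simp only [holds_ball, holds_bex, holds_and, holds_imp, holds_pairMem, holds_eq] at h
  obtain ⟨b, hb, hab, hu⟩ := h ⟨a, hx.star_elem ha⟩ ha
  refine ⟨b, hab, fun b' h' => ?_⟩
  -- Transferred uniqueness concerns only values in `*y`; the inclusion of `*f` in the product shows
  -- that there are no others.
  have hb' : b' ∈ U.star y := by
    have := star_subset hfs (hx.prod hy).1 hf.1 h'
    rw [star_prod hx hy] at this
    exact (ZFSet.pair_mem_prod.1 this).2
  exact congrArg Subtype.val (hu ⟨b', hy.star_elem hb'⟩ hb' h')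

end NonstandardUniverse

open BddFormula NonstandardUniverse FirstOrder.Language

/-! ### Codes of subsets, operations and maps -/

section Codes

variable {B : Type u} {c : B → ZFSet.{u}}

/-- The subset `C` of `B`, seen as a set through `c`. -/
def setCode (c : B → ZFSet.{u}) (C : Set B) : ZFSet.{u} := ZFSet.range fun b : C => c b

/-- The map `j : B → A`, seen as a set-theoretic function through `c` and `d`. -/
def mapCode {A : Type u} (c : B → ZFSet.{u}) (d : A → ZFSet.{u}) (j : B → A) : ZFSet.{u} :=
  ZFSet.range fun b => ZFSet.pair (c b) (d (j b))

theorem mem_setCode {C : Set B} {x : ZFSet.{u}} : x ∈ setCode c C ↔ ∃ b ∈ C, c b = x := by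
  simp [setCode]

theorem mem_relCode {W : Set (B × B)} {x : ZFSet.{u}} :
    x ∈ relCode c W ↔ ∃ a b, (a, b) ∈ W ∧ ZFSet.pair (c a) (c b) = x := by
  simp [relCode]

theorem relCode_subset (W : Set (B × B)) :
    relCode c W ⊆ ZFSet.prod (ZFSet.range c) (ZFSet.range c) := fun x hx => by
  obtain ⟨a, b, -, rfl⟩ := mem_relCode.1 hx
  exact ZFSet.pair_mem_prod.2 ⟨ZFSet.mem_range_self a, ZFSet.mem_range_self b⟩

theorem pair_mem_relCode (hc : Function.Injective c) {W : Set (B × B)} {a b : B} :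
    ZFSet.pair (c a) (c b) ∈ relCode c W ↔ (a, b) ∈ W := by
  simp only [mem_relCode, ZFSet.pair_inj, hc.eq_iff]
  constructor
  · rintro ⟨_, _, h, rfl, rfl⟩; exact h
  · exact fun h => ⟨_, _, h, rfl, rfl⟩

theorem mem_setCode_iff (hc : Function.Injective c) {C : Set B} {b : B} :
    c b ∈ setCode c C ↔ b ∈ C := by
  simp [mem_setCode, hc.eq_iff]

theorem mem_opCode {n : ℕ} {g : (Fin n → B) → B} {x : ZFSet.{u}} :
    x ∈ opCode c g ↔ ∃ b, ZFSet.pair (tuple fun i => c (b i)) (c (g b)) = x := by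
  simp [opCode]

theorem tuple_code_injective (hc : Function.Injective c) {n : ℕ} {a b : Fin n → B}
    (h : tuple (fun i => c (a i)) = tuple fun i => c (b i)) : a = b :=
  funext fun i => hc (congrFun (tuple_injective h) i)

theorem mem_cartPower_range {n : ℕ} {z : ZFSet.{u}} :
    z ∈ cartPower (ZFSet.range c) n ↔ ∃ b : Fin n → B, z = tuple fun i => c (b i) := by
  rw [mem_cartPower]
  constructor
  · rintro ⟨v, hv, rfl⟩
    choose b hb using fun i => ZFSet.mem_range.1 (hv i)
    exact ⟨b, by simp only [hb]⟩
  · rintro ⟨b, rfl⟩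
    exact ⟨_, fun i => ZFSet.mem_range_self _, rfl⟩

theorem isFunc_opCode (hc : Function.Injective c) {n : ℕ} (g : (Fin n → B) → B) :
    ZFSet.IsFunc (cartPower (ZFSet.range c) n) (ZFSet.range c) (opCode c g) := by
  constructor
  · intro p hp
    obtain ⟨b, rfl⟩ := mem_opCode.1 hp
    exact ZFSet.pair_mem_prod.2 ⟨mem_cartPower_range.2 ⟨b, rfl⟩, ZFSet.mem_range_self _⟩
  · intro z hz
    obtain ⟨b, rfl⟩ := mem_cartPower_range.1 hz
    refine ⟨_, mem_opCode.2 ⟨b, rfl⟩, fun y hy => ?_⟩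
    obtain ⟨b', h⟩ := mem_opCode.1 hy
    obtain ⟨h1, rfl⟩ := ZFSet.pair_inj.1 h
    rw [tuple_code_injective hc h1]

theorem mem_mapCode {A : Type u} {d : A → ZFSet.{u}} {j : B → A} {x : ZFSet.{u}} :
    x ∈ mapCode c d j ↔ ∃ b, ZFSet.pair (c b) (d (j b)) = x := by
  simp [mapCode]

theorem isFunc_mapCode {A : Type u} {d : A → ZFSet.{u}} (hc : Function.Injective c) (j : B → A) :
    ZFSet.IsFunc (ZFSet.range c) (ZFSet.range d) (mapCode c d j) := by
  constructor
  · intro p hp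
    obtain ⟨b, rfl⟩ := mem_mapCode.1 hp
    exact ZFSet.pair_mem_prod.2 ⟨ZFSet.mem_range_self _, ZFSet.mem_range_self _⟩
  · intro z hz
    obtain ⟨b, rfl⟩ := ZFSet.mem_range.1 hz
    refine ⟨_, mem_mapCode.2 ⟨b, rfl⟩, fun y hy => ?_⟩
    obtain ⟨b', h⟩ := mem_mapCode.1 hy
    obtain ⟨h1, rfl⟩ := ZFSet.pair_inj.1 h
    rw [hc h1]

end Codes

/-! ### Infinitely close points, compactness and continuity -/

section Coding

variable {U : NonstandardUniverse.{u}} {A : Type u} {c : A → ZFSet.{u}} (hc : IsCoding U.X c)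
include hc

theorem IsCoding.isStdSet_range : U.IsStdSet (ZFSet.range c) := by
  obtain ⟨n, hn⟩ := hc.mem_stage
  refine isStdSet_of_subset (n := n) fun x hx => ?_
  obtain ⟨b, rfl⟩ := ZFSet.mem_range.1 hx
  exact hn b

theorem IsCoding.mem (a : A) : c a ∈ superstructure U.X :=
  hc.isStdSet_range.mem (ZFSet.mem_range_self a)

theorem IsCoding.star_mem (a : A) : U.star (c a) ∈ U.star (ZFSet.range c) :=
  (star_mem_star (hc.mem a) hc.isStdSet_range.1).2 (ZFSet.mem_range_self a)

theorem IsCoding.isStdSet_setCode (C : Set A) : U.IsStdSet (setCode c C) :=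
  hc.isStdSet_range.mono fun x hx => by
    obtain ⟨b, -, rfl⟩ := mem_setCode.1 hx
    exact ZFSet.mem_range_self b

theorem IsCoding.isStdSet_relCode (W : Set (A × A)) : U.IsStdSet (relCode c W) :=
  (hc.isStdSet_range.prod hc.isStdSet_range).mono (relCode_subset W)

theorem IsCoding.isStdSet_opCode {n : ℕ} (g : (Fin n → A) → A) : U.IsStdSet (opCode c g) :=
  ((hc.isStdSet_range.cartPower n).prod hc.isStdSet_range).mono (isFunc_opCode hc.injective g).1

theorem IsCoding.star_isFunc_opCode {n : ℕ} (g : (Fin n → A) → A) :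
    ZFSet.IsFunc (cartPower (U.star (ZFSet.range c)) n) (U.star (ZFSet.range c))
      (U.star (opCode c g)) := by
  rw [← star_cartPower hc.isStdSet_range]
  exact star_isFunc (hc.isStdSet_range.cartPower n) hc.isStdSet_range
    (isFunc_opCode hc.injective g)

theorem IsCoding.mem_of_pair_mem {W : Set (A × A)} {x y : ZFSet.{u}}
    (h : ZFSet.pair x y ∈ U.star (relCode c W)) :
    x ∈ U.star (ZFSet.range c) ∧ y ∈ U.star (ZFSet.range c) := by
  have := star_subset (hc.isStdSet_relCode W) (hc.isStdSet_range.prod hc.isStdSet_range).1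
    (relCode_subset W) h
  rwa [star_prod hc.isStdSet_range hc.isStdSet_range, ZFSet.pair_mem_prod] at this

theorem IsCoding.star_relCode_mono {V W : Set (A × A)} (h : V ⊆ W) :
    U.star (relCode c V) ⊆ U.star (relCode c W) :=
  star_subset (hc.isStdSet_relCode V) (hc.isStdSet_relCode W).1 fun x hx => by
    obtain ⟨a, b, hab, rfl⟩ := mem_relCode.1 hx
    exact mem_relCode.2 ⟨a, b, h hab, rfl⟩

theorem IsCoding.star_relCode_swap {V W : Set (A × A)} (h : ∀ a b, (a, b) ∈ V → (b, a) ∈ W)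
    {x y : ZFSet.{u}} (hxy : ZFSet.pair x y ∈ U.star (relCode c V)) :
    ZFSet.pair y x ∈ U.star (relCode c W) := by
  have := (U.holds_iff (.ball 2 0 (.allPair 2 3 4 (.pairMem 4 3 1)))
    (assign [⟨_, (hc.isStdSet_relCode V).1⟩, ⟨_, (hc.isStdSet_relCode W).1⟩])).1 (by
      simp only [holds_ball, holds_allPair, holds_pairMem, ne_eq, Nat.reduceEqDiff,
        not_false_eq_true]
      rintro ⟨p, hp'⟩ hp ⟨x, hx⟩ ⟨y, hy⟩ (rfl : p = _)
      obtain ⟨a, b, hab, h'⟩ := mem_relCode.1 hp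
      obtain ⟨rfl, rfl⟩ := ZFSet.pair_inj.1 h'
      exact (pair_mem_relCode hc.injective).2 (h a b hab))
  simp only [holds_ball, holds_allPair, holds_pairMem, ne_eq, Nat.reduceEqDiff,
    not_false_eq_true] at this
  obtain ⟨hx, hy⟩ := hc.mem_of_pair_mem hxy
  exact this ⟨_, (hc.isStdSet_relCode V).star_elem hxy⟩ hxy
    ⟨x, hc.isStdSet_range.star_elem hx⟩ ⟨y, hc.isStdSet_range.star_elem hy⟩ rfl

theorem IsCoding.star_relCode_comp {V W : Set (A × A)}
    (h : ∀ a b d, (a, b) ∈ V → (b, d) ∈ V → (a, d) ∈ W) {x y z : ZFSet.{u}}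
    (hxy : ZFSet.pair x y ∈ U.star (relCode c V)) (hyz : ZFSet.pair y z ∈ U.star (relCode c V)) :
    ZFSet.pair x z ∈ U.star (relCode c W) := by
  have hr := hc.isStdSet_range
  have := (U.holds_iff (.ball 3 2 (.ball 4 2 (.ball 5 2 (.imp (.pairMem 3 4 0)
    (.imp (.pairMem 4 5 0) (.pairMem 3 5 1))))))
    (assign [⟨_, (hc.isStdSet_relCode V).1⟩, ⟨_, (hc.isStdSet_relCode W).1⟩, ⟨_, hr.1⟩])).1 (by
      simp only [holds_ball, holds_imp, holds_pairMem]
      rintro ⟨x, hx'⟩ hx ⟨y, hy'⟩ hy ⟨z, hz'⟩ hz h1 h2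
      obtain ⟨a, rfl⟩ := ZFSet.mem_range.1 hx
      obtain ⟨b, rfl⟩ := ZFSet.mem_range.1 hy
      obtain ⟨d, rfl⟩ := ZFSet.mem_range.1 hz
      exact (pair_mem_relCode hc.injective).2 (h a b d ((pair_mem_relCode hc.injective).1 h1)
        ((pair_mem_relCode hc.injective).1 h2)))
  simp only [holds_ball, holds_imp, holds_pairMem] at this
  obtain ⟨hx, hy⟩ := hc.mem_of_pair_mem hxy
  have hz := (hc.mem_of_pair_mem hyz).2
  exact this ⟨x, hr.star_elem hx⟩ hx ⟨y, hr.star_elem hy⟩ hy ⟨z, hr.star_elem hz⟩ hz hxy hyz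

theorem IsCoding.pair_star_mem {W : Set (A × A)} {C : Set A} {a : A}
    (h : ∀ b ∈ C, (b, a) ∈ W) {x : ZFSet.{u}} (hx : x ∈ U.star (setCode c C)) :
    ZFSet.pair x (U.star (c a)) ∈ U.star (relCode c W) := by
  have := (U.holds_iff (.ball 3 0 (.pairMem 3 1 2))
    (assign [⟨_, (hc.isStdSet_setCode C).1⟩, ⟨_, hc.mem a⟩, ⟨_, (hc.isStdSet_relCode W).1⟩])).1 (by
      simp only [holds_ball, holds_pairMem]
      rintro ⟨x, hx'⟩ hx
      obtain ⟨b, hb, rfl⟩ := mem_setCode.1 hx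
      exact (pair_mem_relCode hc.injective).2 (h b hb))
  simp only [holds_ball, holds_pairMem] at this
  exact this ⟨x, (hc.isStdSet_setCode C).star_elem hx⟩ hx

theorem IsCoding.mem_star_setCode {W : Set (A × A)} {C : Set A} {a : A}
    (h : ∀ b, (b, a) ∈ W → b ∈ C) {x : ZFSet.{u}}
    (hx : ZFSet.pair x (U.star (c a)) ∈ U.star (relCode c W)) : x ∈ U.star (setCode c C) := by
  have hr := hc.isStdSet_range
  have := (U.holds_iff (.ball 4 3 (.imp (.pairMem 4 1 2) (.mem 4 0)))
    (assign [⟨_, (hc.isStdSet_setCode C).1⟩, ⟨_, hc.mem a⟩, ⟨_, (hc.isStdSet_relCode W).1⟩,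
      ⟨_, hr.1⟩])).1 (by
      simp only [holds_ball, holds_imp, holds_pairMem, holds_mem]
      rintro ⟨x, hx'⟩ hx hW
      obtain ⟨b, rfl⟩ := ZFSet.mem_range.1 hx
      exact (mem_setCode_iff hc.injective).2 (h b ((pair_mem_relCode hc.injective).1 hW)))
  simp only [holds_ball, holds_imp, holds_pairMem, holds_mem] at this
  have hx' := (hc.mem_of_pair_mem hx).1
  exact this ⟨x, hr.star_elem hx'⟩ hx' hx

/-- Extensions respect finite unions: split `C` into its part inside `D i` and the rest, which the
remaining sets cover. -/
theorem IsCoding.exists_mem_star_of_cover {ι : Type*} (D : ι → Set A) (I : Finset ι) {C : Set A}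
    (h : C ⊆ ⋃ i ∈ I, D i) {x : ZFSet.{u}} (hx : x ∈ U.star (setCode c C)) :
    ∃ i ∈ I, x ∈ U.star (setCode c (D i)) := by
  classical
  induction I using Finset.induction_on generalizing C with
  | empty =>
    have : setCode c C = ∅ := by
      rw [ZFSet.eq_empty]
      intro y hy
      obtain ⟨b, hb, -⟩ := mem_setCode.1 hy
      simpa using h hb
    rw [this, star_empty] at hx
    exact absurd hx (ZFSet.notMem_empty x)
  | insert i I _ ih =>
    have := star_union_subset (hc.isStdSet_setCode C) (hc.isStdSet_setCode (D i)).1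
      (hc.isStdSet_setCode (C \ D i)).1 (fun y hy => by
        obtain ⟨b, hb, rfl⟩ := mem_setCode.1 hy
        simp only [ZFSet.mem_union, mem_setCode_iff hc.injective, Set.mem_sdiff]
        tauto) hx
    rcases ZFSet.mem_union.1 this with h1 | h1
    · exact ⟨i, Finset.mem_insert_self _ _, h1⟩
    · obtain ⟨k, hk, hk'⟩ := ih (fun b hb => by
        have := h hb.1
        simp only [Finset.mem_insert, Set.iUnion_iUnion_eq_or_left, Set.mem_union] at this
        exact this.resolve_left hb.2) h1
      exact ⟨k, Finset.mem_insert_of_mem hk, hk'⟩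

variable [UniformSpace A]

theorem InfClose.symm {x y : ZFSet.{u}} (h : InfClose U c x y) : InfClose U c y x := fun _ hW =>
  hc.star_relCode_swap (fun _ _ h => h) (h _ (UniformSpace.symm (show _ ∈ 𝓤 A from hW)))

theorem InfClose.trans {x y z : ZFSet.{u}} (h : InfClose U c x y) (h' : InfClose U c y z) :
    InfClose U c x z := fun _ hW => by
  obtain ⟨V, hV, hVW⟩ := comp_mem_uniformity_sets hW
  exact hc.star_relCode_comp (fun a b d h1 h2 => hVW ⟨b, h1, h2⟩) (h V hV) (h' V hV)

/-- Every element of the extension of a compact set is infinitely close to a point of the set. -/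
theorem IsCoding.exists_infClose_of_isCompact {C : Set A} (hC : IsCompact C) {x : ZFSet.{u}}
    (hx : x ∈ U.star (setCode c C)) : ∃ a ∈ C, InfClose U c x (U.star (c a)) := by
  by_contra! hcon
  simp only [InfClose, not_forall] at hcon
  -- Otherwise each `a ∈ C` has an entourage `W a` that separates `x` from `a`. Finitely many of the
  -- neighbourhoods `{b | (b, a) ∈ W a}` cover `C`, so `x` lies in the extension of one of them,
  -- which contradicts the choice of `W a`.
  choose! W hW hWx using hcon
  obtain ⟨I, hI, hcov⟩ := hC.elim_nhds_subcover (fun a => {b | (b, a) ∈ W a})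
    fun a ha => mem_nhds_right a (hW a ha)
  obtain ⟨a, ha, hxa⟩ := hc.exists_mem_star_of_cover _ I hcov hx
  exact hWx a (hI a ha) (hc.pair_star_mem (fun b hb => hb) hxa)

/-- A neighbourhood of `a` contains, in the extension, all points infinitely close to `a`. -/
theorem IsCoding.mem_star_of_mem_nhds {C : Set A} {a : A} (hC : C ∈ 𝓝 a) {x : ZFSet.{u}}
    (hx : InfClose U c x (U.star (c a))) : x ∈ U.star (setCode c C) := by
  obtain ⟨W, hW, hWC⟩ := UniformSpace.mem_nhds_iff_symm.1 hC
  exact hc.mem_star_setCode (W := W) (fun b hb => hWC.2 (hWC.1.symm _ _ hb)) (hx W hW)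

/-- Only continuity at the standard point `a` is needed. For fixed `W` it gives a standard entourage
`V`, and the implication from `V`-closeness of the arguments to `W`-closeness of the values is
transferred with `V`, `W` and `a` as parameters. -/
theorem IsCoding.infClose_app {n : ℕ} {g : (Fin n → A) → A} (hg : Continuous g) {a : Fin n → A}
    {x : Fin n → ZFSet.{u}} (hx : ∀ i, InfClose U c (x i) (U.star (c (a i)))) :
    InfClose U c (app (U.star (opCode c g)) (tuple x)) (U.star (c (g a))) := by
  intro W hW
  obtain ⟨V, hV, hVW⟩ : ∃ V ∈ 𝓤 A, ∀ b : Fin n → A, (∀ i, (b i, a i) ∈ V) → (g b, g a) ∈ W := by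
    have h1 : {b | (g b, g a) ∈ W} ∈ 𝓝 a := hg.continuousAt (mem_nhds_right (g a) hW)
    rw [nhds_pi, Filter.mem_pi'] at h1
    obtain ⟨I, T, hT, hTW⟩ := h1
    choose V hV hVT using fun i => UniformSpace.mem_nhds_iff_symm.1 (hT i)
    exact ⟨⋂ i, V i, Filter.iInter_mem.2 hV, fun b hb => hTW fun i _ =>
      (hVT i).2 ((hVT i).1.symm _ _ (Set.mem_iInter.1 (hb i) i))⟩
  have hr := hc.isStdSet_range
  have hta : tuple (fun i => c (a i)) ∈ superstructure U.X :=
    tuple_mem_superstructure fun i => hc.mem _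
  -- The list below fills `v₀` to `v₄` only, so `v₅` takes the default value `∅` of `assign` and can
  -- mark the end of tuples.
  have := (U.holds_iff (.ball 6 0 (.allPair 6 7 8 (.imp (.tupleRel 1 5 n 7 2) (.pairMem 8 3 4))))
    (assign [⟨_, (hc.isStdSet_opCode g).1⟩, ⟨_, (hc.isStdSet_relCode V).1⟩, ⟨_, hta⟩,
      ⟨_, hc.mem (g a)⟩, ⟨_, (hc.isStdSet_relCode W).1⟩])).1 (by
      simp only [holds_ball, holds_allPair, holds_imp, holds_pairMem, ne_eq, Nat.reduceEqDiff,
        not_false_eq_true]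
      rintro ⟨q, hq'⟩ hq ⟨x, hx⟩ ⟨y, hy⟩ (rfl : q = _)
      rw [holds_tupleRel rfl]
      rintro ⟨f, k, hf, hk, hfk⟩
      obtain ⟨b, h'⟩ := mem_opCode.1 hq
      obtain ⟨rfl, rfl⟩ := ZFSet.pair_inj.1 h'
      refine (pair_mem_relCode hc.injective).2 (hVW b fun i => ?_)
      have h1 := congrFun (tuple_injective hf) i
      have h2 := congrFun (tuple_injective hk) i
      have h3 := hfk i
      rw [← h1, ← h2] at h3
      exact (pair_mem_relCode hc.injective).1 h3)
  simp only [holds_ball, holds_allPair, holds_imp, holds_pairMem, ne_eq, Nat.reduceEqDiff,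
        not_false_eq_true] at this
  have hxA : ∀ i, x i ∈ U.star (ZFSet.range c) := fun i =>
    (hc.mem_of_pair_mem (hx i W hW)).1
  have hop := hc.star_isFunc_opCode g
  have htx := tuple_mem_cartPower.2 hxA
  have hq := pair_app_mem hop htx
  refine this ⟨_, (hc.isStdSet_opCode g).star_elem hq⟩ hq
    ⟨_, tuple_mem_superstructure fun i => hr.star_elem (hxA i)⟩
    ⟨_, hr.star_elem (app_mem hop htx)⟩ rfl ?_
  rw [holds_tupleRel NonstandardUniverse.star_empty]
  exact ⟨fun i => ⟨x i, hr.star_elem (hxA i)⟩, fun i => U.st ⟨_, hc.mem (a i)⟩, rfl,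
    star_tuple fun i => hc.mem _, fun i => hx i V hV⟩

end Coding

/-! ### The formula for set-theoretic functions -/

namespace BddFormula

variable {X : ZFSet.{u}} [hX : Fact (IsBaseSet X)] {v : ℕ → superstructure X}

/-- `v_f` is a function from `v_x` to `v_y`, where `v_a` is the set of atoms. -/
def isFunc (x y f a : ℕ) : BddFormula :=
  and (neg (mem f a)) (and
    (ball (x + y + f + 1) f (exPair (x + y + f + 1) (x + y + f + 2) (x + y + f + 3)
      (and (mem (x + y + f + 2) x) (mem (x + y + f + 3) y))))
    (ball (x + y + f + 1) x (bex (x + y + f + 2) y (and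
      (pairMem (x + y + f + 1) (x + y + f + 2) f)
      (ball (x + y + f + 3) y (imp (pairMem (x + y + f + 1) (x + y + f + 3) f)
        (eq (x + y + f + 3) (x + y + f + 2))))))))

/-- The clause excluding atoms matters when the domain is empty: an atom, having no elements in the
superstructure, would then satisfy the other clauses. -/
theorem holds_isFunc {x y f a : ℕ} (ha : (v a).1 = X) (hx : (v x).1 ∉ X) (hy : (v y).1 ∉ X) :
    (isFunc x y f a).Holds v ↔ ZFSet.IsFunc (v x).1 (v y).1 (v f).1 := by
  set N := x + y + f with hN
  have hx' : ∀ k, x ≠ N + (k + 1) := by omega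
  have hy' : ∀ k, y ≠ N + (k + 1) := by omega
  have hf' : ∀ k, f ≠ N + (k + 1) := by omega
  have hne : ∀ k l, k ≠ l → N + k ≠ N + l := by omega
  simp only [isFunc, ← hN, holds_and, holds_neg, holds_mem, holds_ball, holds_bex, holds_imp,
    holds_pairMem, holds_eq, holds_exPair (hne 1 2 (by decide)) (hne 1 3 (by decide))
      (hne 2 3 (by decide)), ha]
  simp only [Function.update_self, Function.update_of_ne (hx' _), Function.update_of_ne (hy' _),
    Function.update_of_ne (hf' _), Function.update_of_ne (hne 1 2 (by decide)),
    Function.update_of_ne (hne 1 3 (by decide)), Function.update_of_ne (hne 2 3 (by decide))]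
  have hmx : ∀ z ∈ (v x).1, z ∈ superstructure X := fun z hz =>
    mem_superstructure_of_mem (v x).2 hx hz
  have hmy : ∀ z ∈ (v y).1, z ∈ superstructure X := fun z hz =>
    mem_superstructure_of_mem (v y).2 hy hz
  constructor
  · rintro ⟨h1, h2, h3⟩
    have hsub : (v f).1 ⊆ ZFSet.prod (v x).1 (v y).1 := fun p hp => by
      obtain ⟨a, b, hab, h⟩ := h2 ⟨p, mem_superstructure_of_mem (v f).2 h1 hp⟩ hp
      exact ZFSet.mem_prod.2 ⟨a, h.1, b, h.2, hab⟩
    refine ⟨hsub, fun z hz => ?_⟩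
    obtain ⟨b, hb, hzb, hu⟩ := h3 ⟨z, hmx z hz⟩ hz
    refine ⟨b, hzb, fun d hd => ?_⟩
    have hdy := (ZFSet.pair_mem_prod.1 (hsub hd)).2
    exact congrArg Subtype.val (hu ⟨d, hmy d hdy⟩ hdy hd)
  · intro hF
    refine ⟨hX.out.notMem_of_forall fun p hp => ?_, ?_, ?_⟩
    · obtain ⟨a, ha, b, hb, rfl⟩ := ZFSet.mem_prod.1 (hF.1 hp)
      exact pair_mem_superstructure (hmx a ha) (hmy b hb)
    · intro p hp
      obtain ⟨a, ha, b, hb, hab⟩ := ZFSet.mem_prod.1 (hF.1 hp)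
      exact ⟨⟨a, hmx a ha⟩, ⟨b, hmy b hb⟩, hab, ha, hb⟩
    · intro a ha
      exact ⟨⟨_, hmy _ (app_mem hF ha)⟩, app_mem hF ha, pair_app_mem hF ha, fun b _ h =>
        Subtype.ext (app_eq hF h).symm⟩

end BddFormula

/-! ### Approximations as coded objects and their formula -/

section Approximation

variable (L : FirstOrder.Language.{s, t})

/-- The set-theoretic function `j` from the algebra with carrier `H` and operations `F` to an
algebra with operations `G` is a `(D, V)`-approximation. -/
structure IsCodedApproximation (H j D V : ZFSet.{u}) (F G : (Σ n, L.Functions n) → ZFSet.{u}) :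
    Prop where
  grid : ∀ x ∈ D, ∃ b ∈ H, ZFSet.pair x (app j b) ∈ V
  hom : ∀ (f : Σ n, L.Functions n) (b : Fin f.1 → ZFSet.{u}), (∀ i, b i ∈ H) →
    (∀ i, app j (b i) ∈ D) → app (G f) (tuple fun i => app j (b i)) ∈ D →
    ZFSet.pair (app (G f) (tuple fun i => app j (b i))) (app j (app (F f) (tuple b))) ∈ V

/-- The coded notion makes sense in both superstructures; this ties it to approximations by actual
maps. As `hj` concerns only values at codes, it covers both a map coded as a set and a map read off
from a set-theoretic function. -/
theorem isCodedApproximation_iff {A B : Type u} [L.Structure A] [L.Structure B]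
    {c : A → ZFSet.{u}} {d : B → ZFSet.{u}} (hc : Function.Injective c)
    (hd : Function.Injective d) {j : B → A} {J : ZFSet.{u}} (hj : ∀ b, app J (d b) = c (j b))
    {C : Set A} {W : Set (A × A)} :
    IsCodedApproximation L (ZFSet.range d) J (setCode c C) (relCode c W)
      (fun f => opCode d (Structure.funMap (M := B) f.2))
      (fun f => opCode c (Structure.funMap (M := A) f.2)) ↔ IsApproximation L C W j := by
  have hA : ∀ (f : Σ n, L.Functions n) (a : Fin f.1 → A),
      app (opCode c (Structure.funMap (M := A) f.2)) (tuple fun i => c (a i)) =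
        c (Structure.funMap f.2 a) := fun f a =>
    app_eq (isFunc_opCode hc _) (mem_opCode.2 ⟨a, rfl⟩)
  have hB : ∀ (f : Σ n, L.Functions n) (b : Fin f.1 → B),
      app (opCode d (Structure.funMap (M := B) f.2)) (tuple fun i => d (b i)) =
        d (Structure.funMap f.2 b) := fun f b =>
    app_eq (isFunc_opCode hd _) (mem_opCode.2 ⟨b, rfl⟩)
  constructor
  · intro h
    refine ⟨fun x hx => ?_, fun {n} g b hb hgb => ?_⟩
    · obtain ⟨y, hy, hxy⟩ := h.grid (c x) ((mem_setCode_iff hc).2 hx)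
      obtain ⟨b, rfl⟩ := ZFSet.mem_range.1 hy
      rw [hj, pair_mem_relCode hc] at hxy
      exact ⟨b, hxy⟩
    · have := h.hom ⟨n, g⟩ (fun i => d (b i)) (fun i => ZFSet.mem_range_self _)
      simp only [hj, hA ⟨n, g⟩, hB ⟨n, g⟩, mem_setCode_iff hc, pair_mem_relCode hc] at this
      exact this hb hgb
  · intro h
    refine ⟨fun x hx => ?_, fun f b hb h1 h2 => ?_⟩
    · obtain ⟨a, ha, rfl⟩ := mem_setCode.1 hx
      obtain ⟨b, hb⟩ := h.grid a ha
      exact ⟨d b, ZFSet.mem_range_self b, by rwa [hj, pair_mem_relCode hc]⟩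
    · choose b' hb' using fun i => ZFSet.mem_range.1 (hb i)
      obtain rfl : (fun i => d (b' i)) = b := funext hb'
      simp only [hj, hA f, hB f, mem_setCode_iff hc, pair_mem_relCode hc] at h1 h2 ⊢
      exact h.hom f.2 b' h1 h2

variable [Finite (Σ n, L.Functions n)]

/-- The tuple of the interpretations of the function symbols. -/
def operationTuple (F : (Σ n, L.Functions n) → ZFSet.{u}) : ZFSet.{u} :=
  tuple fun k => F ((Finite.equivFin (Σ n, L.Functions n)).symm k)

/-- The formula saying that `v₇` is a `(v₃, v₄)`-homomorphism with respect to the operation with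
index `k` of the tuples `v₆` and `v₈`, which has arity `n`; here `v₂` is the target, `v₀ = ∅` and
all operations belong to `v₉`. -/
def homomorphismFormula (k n : ℕ) : BddFormula :=
  .bex 10 9 <| .and (.isComponent 10 k 6) <| .bex 11 9 <| .and (.isComponent 11 k 8) <|
    .ball 12 10 <| .allPair 12 13 14 <| .ball 15 11 <| .allPair 15 16 17 <|
      .imp (.tupleRel 7 0 n 13 16) <| .imp (.tupleMem 3 0 n 16) <| .imp (.mem 17 3) <|
        .ball 18 2 <| .imp (.pairMem 14 18 7) (.pairMem 17 18 4)

/-- Values of functions are named by pairs in their graphs: `⟨v₁₃, v₁₄⟩` in the source operation,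
`⟨v₁₆, v₁₇⟩` in the target operation and `⟨v₁₄, v₁₈⟩` in the map. Since all three are functions,
quantifying over such pairs amounts to evaluating. -/
theorem holds_homomorphismFormula {X : ZFSet.{u}} [hX : Fact (IsBaseSet X)]
    {v : ℕ → superstructure X} {k n : ℕ} {F G : superstructure X}
    (h0 : (v 0).1 = ∅) (h2 : (v 2).1 ∉ X) (h5 : (v 5).1 ∉ X)
    (h6 : ∀ x, IsComponent x k (v 6) ↔ x = F) (h8 : ∀ x, IsComponent x k (v 8) ↔ x = G)
    (hF9 : F.1 ∈ (v 9).1) (hG9 : G.1 ∈ (v 9).1)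
    (hj : ZFSet.IsFunc (v 5).1 (v 2).1 (v 7).1)
    (hF : ZFSet.IsFunc (cartPower (v 5).1 n) (v 5).1 F.1)
    (hG : ZFSet.IsFunc (cartPower (v 2).1 n) (v 2).1 G.1) :
    (homomorphismFormula k n).Holds v ↔
      ∀ b : Fin n → ZFSet.{u}, (∀ i, b i ∈ (v 5).1) → (∀ i, app (v 7).1 (b i) ∈ (v 3).1) →
        app G.1 (tuple fun i => app (v 7).1 (b i)) ∈ (v 3).1 →
        ZFSet.pair (app G.1 (tuple fun i => app (v 7).1 (b i)))
          (app (v 7).1 (app F.1 (tuple b))) ∈ (v 4).1 := by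
  have hm2 : ∀ z ∈ (v 2).1, z ∈ superstructure X := fun z hz =>
    mem_superstructure_of_mem (v 2).2 h2 hz
  have hm5 : ∀ z ∈ (v 5).1, z ∈ superstructure X := fun z hz =>
    mem_superstructure_of_mem (v 5).2 h5 hz
  simp only [homomorphismFormula, holds_bex, holds_and, holds_isComponent]
  constructor
  · rintro ⟨f, -, hf, g, -, hg, h⟩ b hb hbD hGD
    obtain rfl := (h6 _).1 hf
    obtain rfl := (h8 _).1 hg
    simp only [holds_ball, holds_allPair, holds_imp, holds_pairMem, holds_mem, ne_eq,
      Nat.reduceEqDiff, not_false_eq_true] at h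
    have htb : tuple b ∈ cartPower (v 5).1 n := tuple_mem_cartPower.2 hb
    have hja := fun i => app_mem hj (hb i)
    have htx : tuple (fun i => app (v 7).1 (b i)) ∈ cartPower (v 2).1 n :=
      tuple_mem_cartPower.2 hja
    have hd := app_mem hF htb
    have hy := app_mem hG htx
    have hb' : tuple b ∈ superstructure X := tuple_mem_superstructure fun i => hm5 _ (hb i)
    have hx' : tuple (fun i => app (v 7).1 (b i)) ∈ superstructure X :=
      tuple_mem_superstructure fun i => hm2 _ (hja i)
    refine h ⟨_, pair_mem_superstructure hb' (hm5 _ hd)⟩ (pair_app_mem hF htb) ⟨_, hb'⟩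
      ⟨_, hm5 _ hd⟩ rfl ⟨_, pair_mem_superstructure hx' (hm2 _ hy)⟩ (pair_app_mem hG htx)
      ⟨_, hx'⟩ ⟨_, hm2 _ hy⟩ rfl ?_ ?_ hGD ⟨_, hm2 _ (app_mem hj hd)⟩ (app_mem hj hd)
      (pair_app_mem hj hd)
    · exact (holds_tupleRel (by exact h0)).2 ⟨fun i => ⟨b i, hm5 _ (hb i)⟩,
        fun i => ⟨_, hm2 _ (hja i)⟩, rfl, rfl, fun i => pair_app_mem hj (hb i)⟩
    · exact (holds_tupleMem (by exact h0)).2 ⟨fun i => ⟨_, hm2 _ (hja i)⟩, hbD, rfl⟩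
  · intro h
    refine ⟨F, hF9, (h6 _).2 rfl, G, hG9, (h8 _).2 rfl, ?_⟩
    simp only [holds_ball, holds_allPair, holds_imp, holds_pairMem, holds_mem, ne_eq,
      Nat.reduceEqDiff, not_false_eq_true]
    rintro ⟨q, hq'⟩ hq ⟨tb, htb⟩ ⟨d, hd'⟩ (rfl : q = _) ⟨q, hr'⟩ hr ⟨tx, htx⟩ ⟨y, hy'⟩
      (rfl : q = _) h1 h2 hy e he hde
    obtain ⟨b, x, hb, hx, hbx⟩ := (holds_tupleRel (by exact h0)).1 h1
    obtain ⟨x', hx'D, hxx⟩ := (holds_tupleMem (by exact h0)).1 h2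
    replace hb : tb = tuple _ := hb
    replace hx : tx = tuple _ := hx
    replace hxx : tx = tuple _ := hxx
    -- The two subformulas decompose the same tuple, and a tuple determines its components.
    obtain rfl : x = x' := funext fun i =>
      Subtype.ext (congrFun (tuple_injective (hx.symm.trans hxx)) i)
    have hbx' : ∀ i, app (v 7).1 (b i).1 = (x i).1 := fun i => app_eq hj (hbx i)
    have hy1 : app G.1 (tuple fun i => app (v 7).1 (b i).1) = y := by
      simp only [hbx', ← hx]
      exact app_eq hG hr
    have hd1 : app F.1 (tuple fun i => (b i).1) = d := by
      rw [← hb]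
      exact app_eq hF hq
    have := h (fun i => (b i).1) (fun i => (ZFSet.pair_mem_prod.1 (hj.1 (hbx i))).1)
      (fun i => by rw [hbx']; exact hx'D i) (by rw [hy1]; exact hy)
    replace hde : ZFSet.pair d e.1 ∈ (v 7).1 := hde
    rw [hy1, hd1, app_eq hj hde] at this
    exact this

/-- The formula saying that `v₇` is a `(v₃, v₄)`-approximation from the algebra with carrier `v₅`
and tuple of operations `v₆` to the one with carrier `v₂` and tuple of operations `v₈`; here
`v₀ = ∅` and all operations belong to `v₉`. -/
def approximationFormula : BddFormula :=
  .and (.ball 10 3 (.bex 11 5 (.bex 12 2 (.and (.pairMem 11 12 7) (.pairMem 10 12 4)))))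
    (.all (Nat.card (Σ n, L.Functions n)) fun k =>
      homomorphismFormula k ((Finite.equivFin (Σ n, L.Functions n)).symm k).1)

theorem holds_approximationFormula {X : ZFSet.{u}} [hX : Fact (IsBaseSet X)]
    {v : ℕ → superstructure X} {F G : (Σ n, L.Functions n) → superstructure X}
    (h0 : (v 0).1 = ∅) (h2 : (v 2).1 ∉ X) (h3 : (v 3).1 ∉ X) (h5 : (v 5).1 ∉ X)
    (h6 : (v 6).1 = operationTuple L fun f => (F f).1)
    (h8 : (v 8).1 = operationTuple L fun f => (G f).1)
    (hF9 : ∀ f, (F f).1 ∈ (v 9).1) (hG9 : ∀ f, (G f).1 ∈ (v 9).1)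
    (hj : ZFSet.IsFunc (v 5).1 (v 2).1 (v 7).1)
    (hF : ∀ f, ZFSet.IsFunc (cartPower (v 5).1 f.1) (v 5).1 (F f).1)
    (hG : ∀ f, ZFSet.IsFunc (cartPower (v 2).1 f.1) (v 2).1 (G f).1) :
    (approximationFormula L).Holds v ↔
      IsCodedApproximation L (v 5).1 (v 7).1 (v 3).1 (v 4).1 (fun f => (F f).1)
        (fun f => (G f).1) := by
  have hgrid : (ball 10 3 (.bex 11 5 (.bex 12 2 (.and (.pairMem 11 12 7)
      (.pairMem 10 12 4))))).Holds v ↔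
      ∀ x ∈ (v 3).1, ∃ b ∈ (v 5).1, ZFSet.pair x (app (v 7).1 b) ∈ (v 4).1 := by
    simp only [holds_ball, holds_bex, holds_and, holds_pairMem]
    constructor
    · intro h x hx
      obtain ⟨b, hb, y, hy, hby, hxy⟩ := h ⟨x, mem_superstructure_of_mem (v 3).2 h3 hx⟩ hx
      refine ⟨b, hb, ?_⟩
      replace hby : ZFSet.pair b.1 y.1 ∈ (v 7).1 := hby
      rw [app_eq hj hby]
      exact hxy
    · intro h x hx
      obtain ⟨b, hb, hxb⟩ := h x hx
      exact ⟨⟨b, mem_superstructure_of_mem (v 5).2 h5 hb⟩, hb,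
        ⟨_, mem_superstructure_of_mem (v 2).2 h2 (app_mem hj hb)⟩, app_mem hj hb,
        pair_app_mem hj hb, hxb⟩
  set e := Finite.equivFin (Σ n, L.Functions n) with he
  have hk : ∀ (k : Fin _) (F : (Σ n, L.Functions n) → superstructure X) (x y : superstructure X),
      y.1 = operationTuple L (fun f => (F f).1) → (IsComponent x k y ↔ x = F (e.symm k)) :=
    fun k F x y hy => isComponent_tuple (v := fun k => F (e.symm k)) hy k
  have hhom := fun k : Fin (Nat.card (Σ n, L.Functions n)) =>
    holds_homomorphismFormula (k := k) h0 h2 h5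
    (fun x => hk k F x _ h6) (fun x => hk k G x _ h8) (hF9 _) (hG9 _) hj (hF _) (hG _)
  simp only [approximationFormula, holds_and, hgrid, holds_all, ← he, hhom]
  constructor
  · rintro ⟨h1, h2⟩
    refine ⟨h1, fun f => ?_⟩
    have := h2 (e f)
    rwa [e.symm_apply_apply] at this
  · rintro ⟨h1, h2⟩
    exact ⟨h1, fun k => h2 _⟩

end Approximation

/-! ### Elements of extensions, and descent within stages -/

namespace NonstandardUniverse

variable {U : NonstandardUniverse.{u}} {x y z : ZFSet.{u}}

theorem X_mem_superstructure : U.X ∈ superstructure U.X := stage_mem_superstructure 0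

theorem star_elem_notMem (hx : U.IsStdSet x) (h : ∀ y ∈ x, y ∉ U.X) (hy : y ∈ U.star x) :
    y ∉ U.Y := by
  have := (U.holds_iff (.ball 2 0 (.neg (.mem 2 1)))
    (assign [⟨x, hx.1⟩, ⟨U.X, X_mem_superstructure⟩])).1 (by
      simp only [holds_ball, holds_neg, holds_mem]
      exact fun y hy => h y.1 hy)
  simp only [holds_ball, holds_neg, holds_mem] at this
  rw [← U.star_X]
  exact this ⟨y, hx.star_elem hy⟩ hy

theorem star_elem_subset (hx : U.IsStdSet x) (hz : z ∈ superstructure U.X)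
    (h : ∀ y ∈ x, y ∉ U.X ∧ y ⊆ z) (hy : y ∈ U.star x) : y ⊆ U.star z := by
  have := (U.holds_iff (.ball 2 0 (.ball 3 2 (.mem 3 1))) (assign [⟨x, hx.1⟩, ⟨z, hz⟩])).1 (by
      simp only [holds_ball, holds_mem]
      exact fun y hy w hw => (h y.1 hy).2 hw)
  simp only [holds_ball, holds_mem] at this
  have hyY := star_elem_notMem hx (fun y hy => (h y hy).1) hy
  intro w hw
  exact this ⟨y, hx.star_elem hy⟩ hy ⟨w, mem_superstructure_of_mem (hx.star_elem hy) hyY hw⟩ hw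

theorem IsStdSet.powerset (hx : U.IsStdSet x) : U.IsStdSet (ZFSet.powerset x) := by
  obtain ⟨n, hn⟩ := hx.exists_stage
  exact isStdSet_of_subset (n := n + 1) fun y hy =>
    mem_stage_succ_of_subset fun z hz => hn (ZFSet.mem_powerset.1 hy hz)

theorem IsStdSet.notMem_of_mem_powerset (hx : U.IsStdSet x) (hy : y ∈ ZFSet.powerset x) :
    y ∉ U.X :=
  (hx.mono (ZFSet.mem_powerset.1 hy)).2

end NonstandardUniverse

/-- The elements of a non-atom in a stage belong to that stage. This is applied to the pair and to
its element `{x, y}`; neither is an atom, since each has an element in the superstructure. -/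
theorem pair_mem_stage_iff {X : ZFSet.{u}} (hX : IsBaseSet X) {x y : ZFSet.{u}} {n : ℕ}
    (hx : x ∈ superstructure X) (hy : y ∈ superstructure X)
    (h : ZFSet.pair x y ∈ stage X n) : x ∈ stage X n ∧ y ∈ stage X n := by
  have h1 : ({x, y} : ZFSet) ∈ ZFSet.pair x y := by simp [ZFSet.pair]
  have h2 := doubleton_mem_superstructure hx hy
  have h3 := subset_stage_of_mem (hX.notMem_of_mem h1 h2) h h1
  have h4 := subset_stage_of_mem (hX.notMem_of_mem (by simp) hx) h3
  exact ⟨h4 (by simp), h4 (by simp)⟩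

theorem mem_stage_of_tuple_mem_stage {X : ZFSet.{u}} (hX : IsBaseSet X) {m n : ℕ}
    {v : Fin m → ZFSet.{u}} (hv : ∀ i, v i ∈ superstructure X) (h : tuple v ∈ stage X n)
    (i : Fin m) : v i ∈ stage X n := by
  induction m with
  | zero => exact i.elim0
  | succ m ih =>
    obtain ⟨h1, h2⟩ := pair_mem_stage_iff hX (hv 0)
      (tuple_mem_superstructure fun i => hv i.succ) h
    exact Fin.cases h1 (fun i => ih (fun i => hv i.succ) h2 i) i

/-! ### Decoding the elements of `K` and `*K` -/

section Class

variable {L : FirstOrder.Language.{s, t}} [Finite (Σ n, L.Functions n)]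

theorem algebraCode_inj {H H' : ZFSet.{u}} {F F' : (Σ n, L.Functions n) → ZFSet.{u}} :
    algebraCode L H F = algebraCode L H' F' ↔ H = H' ∧ F = F' := by
  constructor
  · intro h
    obtain ⟨h1, h2⟩ := ZFSet.pair_inj.1 h
    refine ⟨h1, funext fun f => ?_⟩
    simpa using congrFun (tuple_injective h2) (Finite.equivFin _ f)
  · rintro ⟨rfl, rfl⟩; rfl

variable {U : NonstandardUniverse.{u}} {K : ZFSet.{u}}
  {𝒦 : Set (CategoryTheory.Bundled.{u} L.Structure)}

theorem Represents.isStdSet (hK : Represents L U K 𝒦) : U.IsStdSet K := by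
  refine ⟨hK.mem, U.base_X.notMem_of_forall fun k hk => ?_⟩
  obtain ⟨B, -, c, hc, rfl⟩ := hK.sound k hk
  exact pair_mem_superstructure hc.isStdSet_range.1
    (tuple_mem_superstructure fun i => (hc.isStdSet_opCode _).1)

/-- The set of the finite sets, as opposed to individuals, in `V_N(X)`. -/
def finiteSubsets (U : NonstandardUniverse.{u}) (N : ℕ) : ZFSet.{u} :=
  (stage U.X N).sep fun d => d ∉ U.X ∧ {y | y ∈ d}.Finite

theorem isStdSet_finiteSubsets (N : ℕ) : U.IsStdSet (finiteSubsets U N) :=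
  isStdSet_of_subset (ZFSet.sep_subset (p := fun d => d ∉ U.X ∧ {y | y ∈ d}.Finite))

theorem mem_finiteSubsets {N : ℕ} {d : ZFSet.{u}} (h : d ∈ finiteSubsets U N) :
    d ∉ U.X ∧ d ⊆ stage U.X N ∧ {y | y ∈ d}.Finite := by
  obtain ⟨h1, h2, h3⟩ := ZFSet.mem_sep.1 h
  exact ⟨h2, subset_stage_of_mem h2 h1, h3⟩

/-- `H` and `F` are the carrier and the operations of an algebra, where `H` and all `F f` belong to
the sets `S` and `T`. -/
structure IsAlgebraIn (S T H : ZFSet.{u}) (F : (Σ n, L.Functions n) → ZFSet.{u}) : Prop where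
  carrier_mem : H ∈ S
  mem : ∀ f, F f ∈ T
  isFunc : ∀ f : (Σ n, L.Functions n), ZFSet.IsFunc (cartPower H f.1) H (F f)

/-- One stage containing `K` as a subset also contains the carriers and operations of all its
algebras, which bounds the quantifiers over them. All larger `N` are allowed so that the same stage
can hold the operations of `A`. -/
theorem Represents.exists_stage (hK : Represents L U K 𝒦) (h𝒦 : ∀ B ∈ 𝒦, Finite B) :
    ∃ N₀, ∀ N ≥ N₀, ∀ k ∈ K, ∃ H F, k = algebraCode L H F ∧
      IsAlgebraIn (finiteSubsets U N) (stage U.X N) H F := by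
  obtain ⟨N₀, hN₀⟩ := hK.isStdSet.exists_stage
  refine ⟨N₀, fun N hN k hk => ?_⟩
  have hkN := stage_mono hN (hN₀ hk)
  obtain ⟨B, hB, c, hc, rfl⟩ := hK.sound k hk
  have := h𝒦 B hB
  have hops := fun f : Σ n, L.Functions n =>
    (hc.isStdSet_opCode (Structure.funMap (M := B) f.2)).1
  obtain ⟨h1, h2⟩ := pair_mem_stage_iff U.base_X hc.isStdSet_range.1
    (tuple_mem_superstructure fun i => hops _) hkN
  refine ⟨_, _, rfl, ZFSet.mem_sep.2 ⟨h1, hc.isStdSet_range.2, ?_⟩, fun f => ?_,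
    fun f => isFunc_opCode hc.injective _⟩
  · refine (Set.finite_range c).subset fun y hy => ?_
    exact ZFSet.mem_range.1 hy
  · have := mem_stage_of_tuple_mem_stage U.base_X (fun i => hops _) h2 (Finite.equivFin _ f)
    rwa [Equiv.symm_apply_apply] at this

/-- `K` is contained in a product of a set of finite sets and a finite power of a stage, and `*`
commutes with products and finite powers; this yields carrier and operations. That each operation is
a function on a power of the carrier is transferred separately for each symbol. -/
theorem star_exists_isAlgebraIn (hKs : U.IsStdSet K) {N : ℕ}
    (hN : ∀ k ∈ K, ∃ H F, k = algebraCode L H F ∧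
      IsAlgebraIn (finiteSubsets U N) (stage U.X N) H F) {k : ZFSet.{u}} (hk : k ∈ U.star K) :
    ∃ H F, k = algebraCode L H F ∧
      IsAlgebraIn (U.star (finiteSubsets U N)) (U.star (stage U.X N)) H F := by
  have hD := isStdSet_finiteSubsets (U := U) N
  have hS := isStdSet_stage (U := U) N
  set e := Finite.equivFin (Σ n, L.Functions n) with he
  have hKsub : K ⊆ ZFSet.prod (finiteSubsets U N) (cartPower (stage U.X N) 
      (Nat.card (Σ n, L.Functions n))) := by
    intro k hk
    obtain ⟨H, F, rfl, h⟩ := hN k hk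
    exact ZFSet.pair_mem_prod.2 ⟨h.carrier_mem, tuple_mem_cartPower.2 fun i => h.mem _⟩
  have hk' := star_subset hKs (hD.prod (hS.cartPower _)).1 hKsub hk
  rw [star_prod hD (hS.cartPower _), star_cartPower hS] at hk'
  obtain ⟨H, hH, t, ht, hkHt⟩ := ZFSet.mem_prod.1 hk'
  obtain ⟨F', hF', rfl⟩ := mem_cartPower.1 ht
  have hHsub : H ⊆ U.star (stage U.X N) := star_elem_subset hD hS.1
    (fun d hd => ⟨(mem_finiteSubsets hd).1, (mem_finiteSubsets hd).2.1⟩) hH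
  have hHY : H ∉ U.Y := star_elem_notMem hD (fun d hd => (mem_finiteSubsets hd).1) hH
  have hHV := hD.star_elem hH
  refine ⟨H, fun f => F' (e f), by simp [algebraCode, hkHt, ← he], hH, fun f => hF' _,
    fun f => ?_⟩
  have hP := hS.cartPower f.1
  -- The domain of the operation has to be a value of a bounded variable: `v₁₀` ranges over the
  -- subsets of the power of the stage, and two clauses force it to consist of exactly the tuples
  -- from the carrier `v₇`.
  have := (U.holds_iff (.ball 6 2 (.allPair 6 7 8 (.bex 9 3 (.and (.isComponent 9 (e f) 8)
    (.bex 10 4 (.and (.and (.ball 11 10 (.tupleMem 7 0 f.1 11))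
      (.ball 11 5 (.imp (.tupleMem 7 0 f.1 11) (.mem 11 10)))) (.isFunc 10 7 9 1)))))))
    (assign [⟨∅, isStdSet_empty.1⟩, ⟨U.X, X_mem_superstructure⟩, ⟨K, hKs.1⟩, ⟨_, hS.1⟩,
      ⟨_, hP.powerset.1⟩, ⟨_, hP.1⟩])).1 (by
    simp only [holds_ball, holds_allPair, holds_bex, holds_and, holds_imp, holds_mem,
      holds_isComponent, ne_eq, Nat.reduceEqDiff, not_false_eq_true]
    rintro ⟨k, hkV⟩ hk ⟨H, hHV⟩ ⟨t, htV⟩ (rfl : k = _)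
    obtain ⟨H', F, hkHF, hA⟩ := hN _ hk
    obtain ⟨h1, h2⟩ := ZFSet.pair_inj.1 hkHF
    replace h1 : H = H' := h1
    replace h2 : t = tuple _ := h2
    subst h1
    obtain ⟨hHX, hHs, -⟩ := mem_finiteSubsets hA.carrier_mem
    have hQ : cartPower H f.1 ⊆ cartPower (stage U.X N) f.1 := cartPower_mono hHs _
    have hFV := fun f => hS.mem (hA.mem f)
    refine ⟨⟨F f, hFV f⟩, hA.mem f, ?_, ⟨cartPower H f.1, (hP.mono hQ).1⟩,
      ZFSet.mem_powerset.2 hQ, ⟨?_, ?_⟩, ?_⟩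
    · refine (isComponent_tuple (v := fun k => ⟨F (e.symm k), hFV _⟩) h2 (e f)).2 ?_
      simp
    · intro b hb
      obtain ⟨g, hg, hbg⟩ := mem_cartPower.1 hb
      exact (holds_tupleMem (by exact rfl)).2
        ⟨fun i => ⟨g i, mem_superstructure_of_mem hHV hHX (hg i)⟩, hg, hbg⟩
    · intro b hb hb'
      obtain ⟨g, hg, hbg⟩ := (holds_tupleMem (by exact rfl)).1 hb'
      exact mem_cartPower.2 ⟨_, hg, hbg⟩
    · exact (holds_isFunc (by exact rfl) (by exact (hP.mono hQ).2) (by exact hHX)).2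
        (by exact hA.isFunc f))
  simp only [holds_ball, holds_allPair, holds_bex, holds_and, holds_imp, holds_mem,
    holds_isComponent, ne_eq, Nat.reduceEqDiff, not_false_eq_true] at this
  have hF'V := fun i => hS.star_elem (hF' i)
  obtain ⟨G, -, hG, Q, hQ, ⟨hQ1, hQ2⟩, hfun⟩ := this ⟨k, hKs.star_elem hk⟩ hk ⟨H, hHV⟩
    ⟨tuple F', tuple_mem_superstructure hF'V⟩ hkHt
  have hGF := (isComponent_tuple (v := fun k => ⟨F' k, hF'V k⟩) (by exact rfl) (e f)).1 hG
  replace hGF : G = ⟨F' (e f), hF'V _⟩ := hGF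
  subst hGF
  replace hQ : Q.1 ∈ U.star (cartPower (stage U.X N) f.1).powerset := hQ
  have hQY : Q.1 ∉ U.Y :=
    star_elem_notMem hP.powerset (fun y hy => hP.notMem_of_mem_powerset hy) hQ
  have hQeq : Q.1 = cartPower H f.1 := by
    ext b
    constructor
    · intro hb
      obtain ⟨g, hg, hbg⟩ := (holds_tupleMem (by exact NonstandardUniverse.star_empty)).1
        (hQ1 ⟨b, mem_superstructure_of_mem Q.2 hQY hb⟩ hb)
      exact mem_cartPower.2 ⟨_, hg, hbg⟩
    · intro hb
      -- As `H` is contained in the extended stage, all its tuples lie within the bound `v₅`.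
      have hbP : b ∈ U.star (cartPower (stage U.X N) f.1) := by
        rw [star_cartPower hS]; exact cartPower_mono hHsub _ hb
      obtain ⟨g, hg, hbg⟩ := mem_cartPower.1 hb
      refine hQ2 ⟨b, hP.star_elem hbP⟩ hbP
        ((holds_tupleMem (by exact NonstandardUniverse.star_empty)).2
        ⟨fun i => ⟨g i, mem_superstructure_of_mem hHV hHY (hg i)⟩, hg, hbg⟩)
  have := (holds_isFunc (by exact U.star_X) (by exact hQY) (by exact hHY)).1 hfun
  rw [← hQeq]
  exact this

end Class

/-! ### The formula for the existence of an approximation -/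

section Existence

variable (L : FirstOrder.Language.{s, t}) [Finite (Σ n, L.Functions n)]

/-- The formula saying that some algebra in `v₅` has a `(v₃, v₄)`-approximation in `v₇` to the
algebra with carrier `v₂` and tuple of operations `v₈`; here `v₀ = ∅`, `v₁` is the set of atoms and
all operations belong to `v₉`. -/
def existsApproximationFormula : BddFormula :=
  .bex 10 5 (.exPair 10 5 6 (.bex 7 7 (.and (.isFunc 5 2 7 1) (approximationFormula L))))

/-- Slots are reused: `v₅` and `v₇` first hold the set of algebras and the set of admissible maps,
then the chosen carrier and map, as `approximationFormula` expects. The base set is arbitrary, so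
that the lemma applies in both superstructures, and `hK` supplies the decoding of algebras. -/
theorem holds_existsApproximationFormula {X : ZFSet.{u}} [hX : Fact (IsBaseSet X)]
    {v : ℕ → superstructure X} {S : ZFSet.{u}} {G : (Σ n, L.Functions n) → superstructure X}
    (h0 : (v 0).1 = ∅) (h1 : (v 1).1 = X) (h2 : (v 2).1 ∉ X) (h3 : (v 3).1 ∉ X) (h5 : (v 5).1 ∉ X)
    (h7 : (v 7).1 ∉ X) (h8 : (v 8).1 = operationTuple L fun f => (G f).1) (h9 : (v 9).1 ∉ X)
    (hG9 : ∀ f, (G f).1 ∈ (v 9).1)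
    (hG : ∀ f, ZFSet.IsFunc (cartPower (v 2).1 f.1) (v 2).1 (G f).1)
    (hS : ∀ H ∈ S, H ∈ superstructure X ∧ H ∉ X)
    (hK : ∀ k ∈ (v 5).1, ∃ H F, k = algebraCode L H F ∧ IsAlgebraIn S (v 9).1 H F) :
    (existsApproximationFormula L).Holds v ↔
      ∃ H F, algebraCode L H F ∈ (v 5).1 ∧ ∃ j ∈ (v 7).1, ZFSet.IsFunc H (v 2).1 j ∧
        IsCodedApproximation L H j (v 3).1 (v 4).1 F (fun f => (G f).1) := by
  have hm5 : ∀ z ∈ (v 5).1, z ∈ superstructure X := fun z hz =>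
    mem_superstructure_of_mem (v 5).2 h5 hz
  have hm7 : ∀ z ∈ (v 7).1, z ∈ superstructure X := fun z hz =>
    mem_superstructure_of_mem (v 7).2 h7 hz
  have hm9 : ∀ z ∈ (v 9).1, z ∈ superstructure X := fun z hz =>
    mem_superstructure_of_mem (v 9).2 h9 hz
  simp only [existsApproximationFormula, holds_bex, holds_and, holds_exPair, ne_eq,
    Nat.reduceEqDiff, not_false_eq_true]
  constructor
  · rintro ⟨⟨k, hkV⟩, hk, ⟨H, hHV⟩, ⟨t, htV⟩, (rfl : k = _), ⟨j, hjV⟩, hj, hf, ha⟩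
    obtain ⟨H', F, hkHF, hA⟩ := hK _ hk
    obtain ⟨rfl, rfl⟩ : H = H' ∧ t = tuple _ := ZFSet.pair_inj.1 hkHF
    have hHX := (hS H hA.carrier_mem).2
    replace hf : ZFSet.IsFunc H (v 2).1 j :=
      (holds_isFunc (by exact h1) (by exact hHX) (by exact h2)).1 hf
    refine ⟨H, F, hk, j, hj, hf, ?_⟩
    exact (holds_approximationFormula L (F := fun f => ⟨F f, hm9 _ (hA.mem f)⟩) (G := G)
      (by exact h0) (by exact h2) (by exact h3) (by exact hHX) (by exact rfl) (by exact h8)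
      (by exact hA.mem) (by exact hG9) (by exact hf) (by exact hA.isFunc) (by exact hG)).1 ha
  · rintro ⟨H, F, hk, j, hj, hf, ha⟩
    obtain ⟨H', F', hkHF, hA⟩ := hK _ hk
    obtain ⟨rfl, rfl⟩ := algebraCode_inj.1 hkHF
    obtain ⟨hHV, hHX⟩ := hS H hA.carrier_mem
    refine ⟨⟨_, hm5 _ hk⟩, hk, ⟨H, hHV⟩,
      ⟨_, tuple_mem_superstructure fun i => hm9 _ (hA.mem _)⟩, rfl, ⟨j, hm7 j hj⟩, hj,
      (holds_isFunc (by exact h1) (by exact hHX) (by exact h2)).2 (by exact hf), ?_⟩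
    exact (holds_approximationFormula L (F := fun f => ⟨F f, hm9 _ (hA.mem f)⟩) (G := G)
      (by exact h0) (by exact h2) (by exact h3) (by exact hHX) (by exact rfl) (by exact h8)
      (by exact hA.mem) (by exact hG9) (by exact hf) (by exact hA.isFunc) (by exact hG)).2 ha

end Existence

/-! ### Saturation for extensions of standard sets -/

section Saturation

variable {U : NonstandardUniverse.{u}}

/-- Saturation for a family of extensions of standard sets with the finite intersection property. -/
theorem NonstandardUniverse.IsSuccSaturated.exists_mem_star {κ : Cardinal.{u}}
    (hU : U.IsSuccSaturated κ) {ι : Type u} (hι : #ι ≤ κ) (S : ι → ZFSet.{u})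
    (hS : ∀ i, U.IsStdSet (S i))
    (h : ∀ I : Finset ι, ∃ z ∈ superstructure U.X, ∀ i ∈ I, z ∈ S i) :
    ∃ z, ∀ i, z ∈ U.star (S i) := by
  classical
  have hint : ∀ x ∈ Set.range fun i => U.star (S i), U.IsInternalSet x := by
    rintro _ ⟨i, rfl⟩
    -- `*(S i)` is internal because it is an element of `*{S i}`.
    have hs : U.IsStdSet {S i} := by
      obtain ⟨n, hn⟩ := (hS i).1
      exact isStdSet_of_subset (n := n) fun x hx => by
        rw [ZFSet.mem_singleton] at hx; exact hx ▸ hn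
    exact ⟨⟨_, hs, (star_mem_star (hS i).1 hs.1).2 (by simp)⟩, (hS i).star_notMem⟩
  have hcard : #(Set.range fun i => U.star (S i)) ≤ Cardinal.lift.{u + 1} κ := by
    have h1 := Cardinal.mk_range_le_lift (f := fun i => U.star (S i))
    rw [Cardinal.lift_id'.{u, u + 1}] at h1
    exact h1.trans (Cardinal.lift_le.2 hι)
  obtain ⟨z, -, hz⟩ := hU _ hint hcard (by
    intro G hG hGf
    lift G to Finset ZFSet.{u} using hGf
    rw [← Set.image_univ, Finset.subset_set_image_iff] at hG
    obtain ⟨I, -, rfl⟩ := hG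
    obtain ⟨z, hz, hzI⟩ := h I
    refine ⟨U.star z, U.star_mem _ hz, fun x hx => ?_⟩
    obtain ⟨i, hi, rfl⟩ := Finset.mem_image.1 hx
    exact (star_mem_star hz (hS i).1).2 (hzI i hi))
  exact ⟨z, fun i => hz _ ⟨i, rfl⟩⟩

end Saturation

/-! ### Sets of pairs of a subset and a relation -/

section Codes

variable {U : NonstandardUniverse.{u}} {A : Type u} {c : A → ZFSet.{u}}

/-- A family of pairs of a subset of `A` and a relation on `A`, seen as a set through `c`. -/
def pairCode (c : A → ZFSet.{u}) (P : Set (Set A × Set (A × A))) : ZFSet.{u} :=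
  ZFSet.range fun p : P => ZFSet.pair (setCode c p.1.1) (relCode c p.1.2)

theorem mem_pairCode {P : Set (Set A × Set (A × A))} {x : ZFSet.{u}} :
    x ∈ pairCode c P ↔ ∃ C W, (C, W) ∈ P ∧ ZFSet.pair (setCode c C) (relCode c W) = x := by
  simp [pairCode]

theorem pairCode_subset (P : Set (Set A × Set (A × A))) :
    pairCode c P ⊆ ZFSet.prod (ZFSet.powerset (ZFSet.range c))
      (ZFSet.powerset (ZFSet.prod (ZFSet.range c) (ZFSet.range c))) := by
  intro x hx
  obtain ⟨C, W, -, rfl⟩ := mem_pairCode.1 hx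
  refine ZFSet.pair_mem_prod.2 ⟨ZFSet.mem_powerset.2 fun y hy => ?_,
    ZFSet.mem_powerset.2 (relCode_subset W)⟩
  obtain ⟨b, -, rfl⟩ := mem_setCode.1 hy
  exact ZFSet.mem_range_self b

variable (hc : IsCoding U.X c)
include hc

theorem IsCoding.isStdSet_pairCode (P : Set (Set A × Set (A × A))) : U.IsStdSet (pairCode c P) :=
  (hc.isStdSet_range.powerset.prod (hc.isStdSet_range.prod hc.isStdSet_range).powerset).mono
    (pairCode_subset P)

theorem IsCoding.exists_eq_pair_of_mem_star {P : Set (Set A × Set (A × A))} {z : ZFSet.{u}}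
    (hz : z ∈ U.star (pairCode c P)) : ∃ D V, z = ZFSet.pair D V ∧ D ∈ superstructure U.Y ∧
      V ∈ superstructure U.Y ∧ D ∉ U.Y := by
  have h1 := hc.isStdSet_range.powerset
  have h2 := (hc.isStdSet_range.prod hc.isStdSet_range).powerset
  have := star_subset (hc.isStdSet_pairCode P) (h1.prod h2).1 (pairCode_subset P) hz
  rw [star_prod h1 h2] at this
  obtain ⟨D, hD, V, hV, rfl⟩ := ZFSet.mem_prod.1 this
  exact ⟨D, V, rfl, h1.star_elem hD, h2.star_elem hV,
    star_elem_notMem h1 (fun y hy => hc.isStdSet_range.notMem_of_mem_powerset hy) hD⟩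

theorem IsCoding.subset_of_pair_mem_star {P : Set (Set A × Set (A × A))} {C : Set A}
    (h : ∀ p ∈ P, C ⊆ p.1) {D V : ZFSet.{u}} (hD : D ∈ superstructure U.Y)
    (hV : V ∈ superstructure U.Y) (hz : ZFSet.pair D V ∈ U.star (pairCode c P)) :
    U.star (setCode c C) ⊆ D := by
  have := (U.holds_iff (.ball 2 0 (.allPair 2 3 4 (.ball 5 1 (.mem 5 3))))
    (assign [⟨_, (hc.isStdSet_pairCode P).1⟩, ⟨_, (hc.isStdSet_setCode C).1⟩])).1 (by
      simp only [holds_ball, holds_allPair, holds_mem, ne_eq, Nat.reduceEqDiff,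
        not_false_eq_true]
      rintro ⟨z, hz'⟩ hz ⟨D, hD⟩ ⟨V, hV⟩ (rfl : z = _) ⟨x, hx'⟩ hx
      obtain ⟨C', W, hP, h'⟩ := mem_pairCode.1 hz
      obtain ⟨rfl, rfl⟩ := ZFSet.pair_inj.1 h'
      obtain ⟨b, hb, rfl⟩ := mem_setCode.1 hx
      exact mem_setCode.2 ⟨b, h _ hP hb, rfl⟩)
  simp only [holds_ball, holds_allPair, holds_mem, ne_eq, Nat.reduceEqDiff,
    not_false_eq_true] at this
  intro x hx
  exact this ⟨_, (hc.isStdSet_pairCode P).star_elem hz⟩ hz ⟨D, hD⟩ ⟨V, hV⟩ rfl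
    ⟨x, (hc.isStdSet_setCode C).star_elem hx⟩ hx

theorem IsCoding.mem_star_of_pair_mem_star {P : Set (Set A × Set (A × A))} {W : Set (A × A)}
    (h : ∀ p ∈ P, p.2 ⊆ W) {D V x : ZFSet.{u}} (hD : D ∈ superstructure U.Y)
    (hV : V ∈ superstructure U.Y) (hz : ZFSet.pair D V ∈ U.star (pairCode c P))
    (hx : x ∈ superstructure U.Y) (hxV : x ∈ V) : x ∈ U.star (relCode c W) := by
  have := (U.holds_iff (.ball 2 0 (.allPair 2 3 4 (.ball 5 4 (.mem 5 1))))
    (assign [⟨_, (hc.isStdSet_pairCode P).1⟩, ⟨_, (hc.isStdSet_relCode W).1⟩])).1 (by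
      simp only [holds_ball, holds_allPair, holds_mem, ne_eq, Nat.reduceEqDiff,
        not_false_eq_true]
      rintro ⟨z, hz'⟩ hz ⟨D, hD⟩ ⟨V, hV⟩ (rfl : z = _) ⟨x, hx'⟩ hx
      obtain ⟨C, V', hP, h'⟩ := mem_pairCode.1 hz
      obtain ⟨rfl, rfl⟩ := ZFSet.pair_inj.1 h'
      obtain ⟨a, b, hab, rfl⟩ := mem_relCode.1 hx
      exact mem_relCode.2 ⟨a, b, h _ hP hab, rfl⟩)
  simp only [holds_ball, holds_allPair, holds_mem, ne_eq, Nat.reduceEqDiff,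
    not_false_eq_true] at this
  exact this ⟨_, (hc.isStdSet_pairCode P).star_elem hz⟩ hz ⟨D, hD⟩ ⟨V, hV⟩ rfl ⟨x, hx⟩ hxV

end Codes

/-! ### A scale beyond all standard scales -/

section Enlargement

variable {A : Type u} [UniformSpace A]

theorem RelCompactSections.mono {V W : Set (A × A)} (hW : RelCompactSections W) (h : V ⊆ W) :
    RelCompactSections V := fun x =>
  (hW x).of_isClosed_subset isClosed_closure (closure_mono fun _ hy => h hy)

/-- The pairs of a compact set and an entourage with relatively compact sections. -/
def approximationScales (A : Type u) [UniformSpace A] : Set (Set A × Set (A × A)) :=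
  {p | IsCompact p.1 ∧ p.2 ∈ 𝓤 A ∧ RelCompactSections p.2}

/-- A nonstandard pair of a compact set and an entourage that lies beyond all standard ones. -/
theorem exists_star_scale (hT2 : T2Space A) (hA : ∃ W ∈ 𝓤 A, RelCompactSections W)
    {κ : Cardinal.{u}} (hκ : ℵ₀ ≤ κ) (hκ_top : TopologyWeightLE A κ)
    (hκ_unif : UniformityWeightLE A κ) {U : NonstandardUniverse.{u}} (hU : U.IsSuccSaturated κ)
    {c : A → ZFSet.{u}} (hc : IsCoding U.X c) :
    ∃ D V, ZFSet.pair D V ∈ U.star (pairCode c (approximationScales A)) ∧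
      D ∈ superstructure U.Y ∧ V ∈ superstructure U.Y ∧ D ∉ U.Y ∧
      (∀ x, IsNearstandard U c x → x ∈ D) ∧
      ∀ x y, x ∈ superstructure U.Y → y ∈ superstructure U.Y → ZFSet.pair x y ∈ V →
        InfClose U c x y := by
  classical
  obtain ⟨W₀, hW₀, hW₀c⟩ := hA
  obtain ⟨𝓑, h𝓑, h𝓑κ⟩ := hκ_top
  obtain ⟨𝓦, h𝓦, h𝓦κ⟩ := hκ_unif
  -- Adding `∅` makes `Q` nonempty even when `A` is empty, so every basic entourage occurs in some
  -- index of `Q × 𝓦`.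
  let Q : Set (Set A) := insert ∅ {B ∈ 𝓑 | IsCompact (closure B)}
  have hQ : ∀ B ∈ Q, IsCompact (closure B) := by
    rintro B (rfl | hB)
    · simp
    · exact hB.2
  have hQκ : #Q ≤ κ := by
    refine (Cardinal.mk_insert_le).trans (Cardinal.add_le_of_le hκ ?_ ?_)
    · exact (Cardinal.mk_le_mk_of_subset fun B hB => hB.1).trans h𝓑κ
    · exact Cardinal.one_le_aleph0.trans hκ
  let P : Q × 𝓦 → Set (Set A × Set (A × A)) := fun i =>
    {p ∈ approximationScales A | closure i.1.1 ⊆ p.1 ∧ p.2 ⊆ i.2.1}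
  obtain ⟨z, hz⟩ := hU.exists_mem_star (ι := Q × 𝓦)
    (by
      rw [Cardinal.mk_prod, Cardinal.lift_id, Cardinal.lift_id]
      exact Cardinal.mul_le_of_le hκ hQκ h𝓦κ)
    (fun i => pairCode c (P i)) (fun i => hc.isStdSet_pairCode _) (by
      intro I
      -- Finite intersection property: a finite union of compact closures is compact, and
      -- intersecting with `W₀` keeps the sections relatively compact.
      have hp : ((⋃ i ∈ I, closure i.1.1, W₀ ∩ ⋂ i ∈ I, i.2.1) : Set A × Set (A × A)) ∈
          approximationScales A :=
        ⟨I.isCompact_biUnion fun i _ => hQ _ i.1.2,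
          Filter.inter_mem hW₀ ((Filter.biInter_finset_mem I).2 fun i _ =>
            h𝓦.mem_of_mem i.2.2), hW₀c.mono Set.inter_subset_left⟩
      refine ⟨_, (hc.isStdSet_pairCode _).mem (mem_pairCode.2 ⟨_, _, hp, rfl⟩), fun i hi =>
        mem_pairCode.2 ⟨_, _, ⟨hp, ?_, ?_⟩, rfl⟩⟩
      · exact Set.subset_biUnion_of_mem (u := fun i : Q × 𝓦 => closure i.1.1) hi
      · exact Set.inter_subset_right.trans
          (Set.biInter_subset_of_mem (t := fun i : Q × 𝓦 => i.2.1) hi))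
  obtain ⟨W₁, hW₁, -⟩ := h𝓦.mem_iff.1 Filter.univ_mem
  let q₀ : Q := ⟨∅, Set.mem_insert _ _⟩
  obtain ⟨D, V, rfl, hD, hV, hDY⟩ := hc.exists_eq_pair_of_mem_star (hz (q₀, ⟨W₁, hW₁⟩))
  refine ⟨D, V, ?_, hD, hV, hDY, ?_, ?_⟩
  · refine star_subset (hc.isStdSet_pairCode _) (hc.isStdSet_pairCode _).1 ?_
      (hz (q₀, ⟨W₁, hW₁⟩))
    intro x hx
    obtain ⟨C, W, hCW, rfl⟩ := mem_pairCode.1 hx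
    exact mem_pairCode.2 ⟨C, W, hCW.1, rfl⟩
  · rintro x ⟨-, a, ha⟩
    -- The standard point `a` has a basic neighbourhood `B` inside the compact closure of `W₀(a)`.
    -- Then `B` belongs to `Q`, and `x ≈ a` lies in the extension of its closure, which is contained
    -- in `D`.
    have hKa : closure (UniformSpace.ball a W₀) ∈ 𝓝 a :=
      Filter.mem_of_superset (UniformSpace.ball_mem_nhds a hW₀) subset_closure
    obtain ⟨B, hB, haB, hBK⟩ := h𝓑.mem_nhds_iff.1 hKa
    have hBc : IsCompact (closure B) :=
      (hW₀c a).of_isClosed_subset isClosed_closure (closure_minimal hBK isClosed_closure)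
    have hBQ : B ∈ Q := Or.inr ⟨hB, hBc⟩
    refine hc.subset_of_pair_mem_star (P := P (⟨B, hBQ⟩, ⟨W₁, hW₁⟩)) (fun p hp => hp.2.1) hD hV
      (hz _) (hc.mem_star_of_mem_nhds ?_ ha)
    exact Filter.mem_of_superset ((h𝓑.isOpen hB).mem_nhds haB) subset_closure
  · intro x y hx hy hxy W hW
    obtain ⟨W', hW', hW'W⟩ := h𝓦.mem_iff.1 hW
    exact hc.star_relCode_mono hW'W (hc.mem_star_of_pair_mem_star (P := P (q₀, ⟨W', hW'⟩))
      (fun p hp => hp.2.2) hD hV (hz _) (pair_mem_superstructure hx hy) hxy)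

end Enlargement

/-! ### The existence formula read in each universe -/

section Transfer

variable {L : FirstOrder.Language.{s, t}} [Finite (Σ n, L.Functions n)] {A : Type u}
  [L.Structure A] {U : NonstandardUniverse.{u}} {c : A → ZFSet.{u}} {K : ZFSet.{u}}
  {𝒦 : Set (CategoryTheory.Bundled.{u} L.Structure)}

variable (L c) in
/-- The interpretations of the function symbols in `A`, seen as sets through `c`. -/
def operationCode (f : Σ n, L.Functions n) : ZFSet.{u} :=
  opCode c (Structure.funMap (M := A) f.2)

theorem holds_existsApproximationFormula_standard (hc : IsCoding U.X c) (hK : U.IsStdSet K) {N : ℕ}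
    (hN : ∀ k ∈ K, ∃ H F, k = algebraCode L H F ∧
      IsAlgebraIn (finiteSubsets U N) (stage U.X N) H F)
    (hop : ∀ f, operationCode L c f ∈ stage U.X N) {v : ℕ → superstructure U.X}
    (h0 : (v 0).1 = ∅) (h1 : (v 1).1 = U.X) (h2 : (v 2).1 = ZFSet.range c) (h3 : (v 3).1 ∉ U.X)
    (h5 : (v 5).1 = K) (h7 : (v 7).1 ∉ U.X) (h8 : (v 8).1 = operationTuple L (operationCode L c))
    (h9 : (v 9).1 = stage U.X N) :
    (existsApproximationFormula L).Holds v ↔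
      ∃ H F, algebraCode L H F ∈ K ∧ ∃ j ∈ (v 7).1, ZFSet.IsFunc H (ZFSet.range c) j ∧
        IsCodedApproximation L H j (v 3).1 (v 4).1 F (operationCode L c) := by
  have hS := isStdSet_stage (U := U) N
  rw [holds_existsApproximationFormula L (S := finiteSubsets U N)
    (G := fun f => ⟨_, hS.mem (hop f)⟩) h0 h1 (h2 ▸ hc.isStdSet_range.2) h3 (h5 ▸ hK.2) h7 h8
    (h9 ▸ hS.2) (fun f => by rw [h9]; exact hop f)
    (fun f => by rw [h2]; exact isFunc_opCode hc.injective _)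
    (fun H hH => ⟨(isStdSet_finiteSubsets N).mem hH, (mem_finiteSubsets hH).1⟩)
    (by rw [h5, h9]; exact hN), h2, h5]

/-- The decoding of algebras comes here from `star_exists_isAlgebraIn`. The sets `v₃` and `v₄` may
be nonstandard, which the forward direction needs. -/
theorem holds_existsApproximationFormula_star (hc : IsCoding U.X c) (hK : U.IsStdSet K) {N : ℕ}
    (hN : ∀ k ∈ K, ∃ H F, k = algebraCode L H F ∧
      IsAlgebraIn (finiteSubsets U N) (stage U.X N) H F)
    (hop : ∀ f, operationCode L c f ∈ stage U.X N) {v : ℕ → superstructure U.Y}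
    (h0 : (v 0).1 = ∅) (h1 : (v 1).1 = U.Y) (h2 : (v 2).1 = U.star (ZFSet.range c))
    (h3 : (v 3).1 ∉ U.Y) (h5 : (v 5).1 = U.star K) (h7 : (v 7).1 ∉ U.Y)
    (h8 : (v 8).1 = U.star (operationTuple L (operationCode L c)))
    (h9 : (v 9).1 = U.star (stage U.X N)) :
    (existsApproximationFormula L).Holds v ↔
      ∃ H F, algebraCode L H F ∈ U.star K ∧ ∃ j ∈ (v 7).1,
        ZFSet.IsFunc H (U.star (ZFSet.range c)) j ∧
        IsCodedApproximation L H j (v 3).1 (v 4).1 F (fun f => U.star (operationCode L c f)) := by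
  have hS := isStdSet_stage (U := U) N
  have hD := isStdSet_finiteSubsets (U := U) N
  have hopV := fun f => hS.mem (hop f)
  rw [holds_existsApproximationFormula L (S := U.star (finiteSubsets U N))
    (G := fun f => U.st ⟨_, hopV f⟩) h0 h1 (h2 ▸ hc.isStdSet_range.star_notMem) h3
    (h5 ▸ hK.star_notMem) h7 (h8.trans (star_tuple fun i => hopV _)) (h9 ▸ hS.star_notMem)
    (fun f => by rw [h9]; exact (star_mem_star (hopV f) hS.1).2 (hop f))
    (fun f => by rw [h2]; exact hc.star_isFunc_opCode _)
    (fun H hH => ⟨hD.star_elem hH, star_elem_notMem hD (fun d hd => (mem_finiteSubsets hd).1) hH⟩)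
    (by rw [h5, h9]; exact fun k hk => star_exists_isAlgebraIn hK hN hk), h2, h5]
  rfl

theorem Represents.exists_isApproximation (hK : Represents L U K 𝒦) (hc : IsCoding U.X c)
    {C : Set A} {W : Set (A × A)} {H j : ZFSet.{u}} {F : (Σ n, L.Functions n) → ZFSet.{u}}
    (hHF : algebraCode L H F ∈ K) (hj : ZFSet.IsFunc H (ZFSet.range c) j)
    (h : IsCodedApproximation L H j (setCode c C) (relCode c W) F (operationCode L c)) :
    ∃ B ∈ 𝒦, ∃ j : B → A, IsApproximation L C W j := by
  obtain ⟨B, hB, d, hd, hHFB⟩ := hK.sound _ hHF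
  obtain ⟨rfl, rfl⟩ := algebraCode_inj.1 hHFB
  choose j' hj' using fun b => ZFSet.mem_range.1 (app_mem hj (ZFSet.mem_range_self b))
  exact ⟨B, hB, j', (isCodedApproximation_iff L hc.injective hd.injective
    fun b => (hj' b).symm).1 h⟩

/-- All carriers are subsets of `R`, so the graph of `j` belongs to one fixed power set. This bounds
the quantifier over maps. -/
theorem Represents.exists_isCodedApproximation (hK : Represents L U K 𝒦) (hc : IsCoding U.X c)
    {S T R : ZFSet.{u}} (hS : ∀ H ∈ S, H ⊆ R)
    (hN : ∀ k ∈ K, ∃ H F, k = algebraCode L H F ∧ IsAlgebraIn S T H F)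
    {C : Set A} {W : Set (A × A)} (h : ∃ B ∈ 𝒦, ∃ j : B → A, IsApproximation L C W j) :
    ∃ H F, algebraCode L H F ∈ K ∧ ∃ j ∈ ZFSet.powerset (ZFSet.prod R (ZFSet.range c)),
      ZFSet.IsFunc H (ZFSet.range c) j ∧
      IsCodedApproximation L H j (setCode c C) (relCode c W) F (operationCode L c) := by
  obtain ⟨B, hB, j, hj⟩ := h
  obtain ⟨d, hd, hdK⟩ := hK.complete B hB
  have hf := isFunc_mapCode (d := c) hd.injective j
  obtain ⟨H, F, hHF, hA⟩ := hN _ hdK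
  obtain ⟨rfl, -⟩ := algebraCode_inj.1 hHF
  refine ⟨_, _, hdK, _, ZFSet.mem_powerset.2 fun p hp => ?_, hf,
    (isCodedApproximation_iff L hc.injective hd.injective
      fun b => app_eq hf (mem_mapCode.2 ⟨b, rfl⟩)).2 hj⟩
  obtain ⟨a, ha, b, hb, rfl⟩ := ZFSet.mem_prod.1 (hf.1 hp)
  exact ZFSet.pair_mem_prod.2 ⟨hS _ hA.carrier_mem ha, hb⟩

theorem exists_stage_operationCode (hc : IsCoding U.X c) :
    ∃ N₀, ∀ N ≥ N₀, ∀ f, operationCode L c f ∈ stage U.X N := by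
  choose n hn using fun f : Σ n, L.Functions n =>
    (hc.isStdSet_opCode (Structure.funMap (M := A) f.2)).1
  obtain ⟨N₀, hN₀⟩ := (Set.finite_range n).bddAbove
  exact ⟨N₀, fun N hN f => stage_mono ((hN₀ ⟨f, rfl⟩).trans hN) (hn f)⟩

end Transfer

/-! ### From hyperfinite approximations to coded ones and back -/

section Main

variable {L : FirstOrder.Language.{s, t}} {A : Type u} [UniformSpace A] [L.Structure A]
  {U : NonstandardUniverse.{u}} {c : A → ZFSet.{u}} {K : ZFSet.{u}}
  {𝒦 : Set (CategoryTheory.Bundled.{u} L.Structure)}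

/-- Compactness makes every point of `*C` nearstandard. For the grid, pass from such a point to a
standard one and from there to a value of `j`; for the operations, the homomorphism condition
applies directly. -/
theorem IsHyperfiniteApproximation.isCodedApproximation
    (hc : IsCoding U.X c) {H j : ZFSet.{u}} {F : (Σ n, L.Functions n) → ZFSet.{u}}
    (h : IsHyperfiniteApproximation U c L H F j) {C : Set A} (hC : IsCompact C) {W : Set (A × A)}
    (hW : W ∈ 𝓤 A) :
    IsCodedApproximation L H j (U.star (setCode c C)) (U.star (relCode c W)) F
      (fun f => U.star (operationCode L c f)) where
  grid x hx := by
    obtain ⟨a, -, hxa⟩ := hc.exists_infClose_of_isCompact hC hx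
    obtain ⟨b, hb, hba⟩ := h.dense a
    exact ⟨b, hb, hxa.trans hc (hba.symm hc) W hW⟩
  hom f b hb hbC _ := by
    refine (h.hom f.2 b hb fun i => ⟨app_mem h.isFunc (hb i), ?_⟩).symm hc W hW
    obtain ⟨a, -, ha⟩ := hc.exists_infClose_of_isCompact hC (hbC i)
    exact ⟨a, ha⟩

/-- By continuity, an operation takes nearstandard arguments to a nearstandard value. Arguments and
value thus all lie in `D`, so the homomorphism condition of the coded approximation applies, and
`V`-closeness implies `≈`. -/
theorem IsCodedApproximation.isHyperfiniteApproximation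
    (hcont : ∀ {n : ℕ} (g : L.Functions n),
      Continuous fun a : Fin n → A => Structure.funMap g a)
    (hc : IsCoding U.X c) {H j D V : ZFSet.{u}} {F : (Σ n, L.Functions n) → ZFSet.{u}}
    (h : IsCodedApproximation L H j D V F (fun f => U.star (operationCode L c f)))
    (hF : ∀ f : (Σ n, L.Functions n), ZFSet.IsFunc (cartPower H f.1) H (F f))
    (hjint : U.IsInternal j) (hj : ZFSet.IsFunc H (U.star (ZFSet.range c)) j)
    (hD : ∀ x, IsNearstandard U c x → x ∈ D)
    (hV : ∀ x y, x ∈ superstructure U.Y → y ∈ superstructure U.Y → ZFSet.pair x y ∈ V →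
      InfClose U c x y) :
    IsHyperfiniteApproximation U c L H F j := by
  have hA := hc.isStdSet_range
  have hrefl : ∀ a, InfClose U c (U.star (c a)) (U.star (c a)) := fun a W hW => by
    rw [← star_pair (hc.mem a) (hc.mem a),
      star_mem_star (pair_mem_superstructure (hc.mem a) (hc.mem a)) (hc.isStdSet_relCode W).1,
      pair_mem_relCode hc.injective]
    exact refl_mem_uniformity hW
  refine ⟨hjint, hj, fun a => ?_, fun {n} g b hb hns => ?_⟩
  · obtain ⟨b, hb, hab⟩ := h.grid _ (hD _ ⟨hc.star_mem a, a, hrefl a⟩)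
    exact ⟨b, hb, (hV _ _ (hA.star_elem (hc.star_mem a)) (hA.star_elem (app_mem hj hb)) hab).symm
      hc⟩
  · choose a ha using fun i => (hns i).2
    have hop := app_mem (hc.star_isFunc_opCode (Structure.funMap (M := A) g))
      (tuple_mem_cartPower.2 fun i => app_mem hj (hb i))
    have hclose := hc.infClose_app (hcont g) ha
    refine (hV _ _ (hA.star_elem hop) (hA.star_elem (app_mem hj (app_mem (hF ⟨n, g⟩)
      (tuple_mem_cartPower.2 hb)))) ?_).symm hc
    exact h.hom ⟨n, g⟩ b hb (fun i => hD _ (hns i)) (hD _ ⟨hop, _, hclose⟩)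

end Main
end

theorem theorem2
    (L : FirstOrder.Language.{s, t}) [L.IsAlgebraic] [Finite (Σ n, L.Functions n)]
    (A : Type u) [UniformSpace A] [L.Structure A]
    (hA : IsUniformlyLocallyCompactAlgebra L A)
    (κ : Cardinal.{u}) (hκ : ℵ₀ ≤ κ)
    (hκ_top : TopologyWeightLE A κ) (hκ_unif : UniformityWeightLE A κ)
    (U : NonstandardUniverse.{u}) (hU : U.IsSuccSaturated κ)
    (c : A → ZFSet.{u}) (hc : IsCoding U.X c)
    (𝒦 : Set (CategoryTheory.Bundled.{u} L.Structure)) (h𝒦 : ∀ B ∈ 𝒦, Finite B)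
    (K : ZFSet.{u}) (hK : Represents L U K 𝒦) :
    IsApproximableBy L A 𝒦 ↔
      ∃ (H : ZFSet.{u}) (F : (Σ n, L.Functions n) → ZFSet.{u}) (j : ZFSet.{u}),
        IsHyperfiniteAlgebra L U H F ∧ algebraCode L H F ∈ U.star K ∧
          IsHyperfiniteApproximation U c L H F j := by
  obtain ⟨N₁, hN₁⟩ := hK.exists_stage h𝒦
  obtain ⟨N₂, hN₂⟩ := exists_stage_operationCode (L := L) hc
  have hN := hN₁ _ (le_max_left N₁ N₂)
  have hop := hN₂ _ (le_max_right N₁ N₂)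
  set N := max N₁ N₂
  have hKs := hK.isStdSet
  have hemp := empty_mem_superstructure (X := U.X)
  have hX := NonstandardUniverse.X_mem_superstructure (U := U)
  have hS := NonstandardUniverse.isStdSet_stage (U := U) N
  have hD := isStdSet_finiteSubsets (U := U) N
  have hAs := hc.isStdSet_range
  have hopV : operationTuple L (operationCode L c) ∈ superstructure U.X :=
    tuple_mem_superstructure fun i => hS.mem (hop _)
  constructor
  · intro happ
    have hJ := (hS.prod hAs).powerset
    have hE := hc.isStdSet_pairCode (approximationScales A)
    obtain ⟨D, V, hDV, hDs, hVs, hDY, hDns, hVcl⟩ := exists_star_scale hA.t2 hA.exists_relCompact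
      hκ hκ_top hκ_unif hU hc
    have key := (U.holds_iff (.ball 11 3 (.allPair 11 3 4 (existsApproximationFormula L)))
      (assign [⟨∅, hemp⟩, ⟨U.X, hX⟩, ⟨_, hAs.1⟩, ⟨_, hE.1⟩,
        ⟨∅, hemp⟩, ⟨K, hKs.1⟩, ⟨∅, hemp⟩, ⟨_, hJ.1⟩, ⟨_, hopV⟩,
        ⟨_, hS.1⟩])).1 (by
      simp only [BddFormula.holds_ball, BddFormula.holds_allPair, ne_eq, Nat.reduceEqDiff,
        not_false_eq_true]
      rintro ⟨p, hpV⟩ hp ⟨D, hD'⟩ ⟨V, hV'⟩ (rfl : p = _)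
      obtain ⟨C, W, ⟨hC, hW, hWc⟩, h'⟩ := mem_pairCode.1 hp
      obtain ⟨rfl, rfl⟩ := ZFSet.pair_inj.1 h'
      refine (holds_existsApproximationFormula_standard hc hKs hN hop (by exact rfl) (by exact rfl)
        (by exact rfl) (by exact (hc.isStdSet_setCode C).2) (by exact rfl) (by exact hJ.2)
        (by exact rfl) (by exact rfl)).2 ?_
      exact hK.exists_isCodedApproximation hc (fun H hH => (mem_finiteSubsets hH).2.1) hN
        (happ C hC W hW hWc))
    simp only [BddFormula.holds_ball, BddFormula.holds_allPair, ne_eq, Nat.reduceEqDiff,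
      not_false_eq_true] at key
    have key' := key ⟨_, hE.star_elem hDV⟩ hDV ⟨D, hDs⟩ ⟨V, hVs⟩ rfl
    obtain ⟨H, F, hHF, j, hj, hjf, h⟩ := (holds_existsApproximationFormula_star hc hKs hN hop
      (by exact NonstandardUniverse.star_empty) (by exact U.star_X) (by exact rfl) (by exact hDY)
      (by exact rfl) (by exact hJ.star_notMem) (by exact rfl) (by exact rfl)).1 key'
    replace hj : j ∈ U.star (ZFSet.powerset (ZFSet.prod (stage U.X N) (ZFSet.range c))) := hj
    obtain ⟨H', F', hHF', hAl⟩ := star_exists_isAlgebraIn hKs hN hHF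
    obtain ⟨rfl, rfl⟩ := algebraCode_inj.1 hHF'
    exact ⟨H, F, j, ⟨⟨_, hD, fun d hd => ⟨(mem_finiteSubsets hd).1, (mem_finiteSubsets hd).2.2⟩,
      hAl.carrier_mem⟩, fun f => ⟨_, hS, hAl.mem f⟩, hAl.isFunc⟩, hHF,
      h.isHyperfiniteApproximation hA.continuous_funMap hc hAl.isFunc ⟨_, hJ, hj⟩ hjf hDns hVcl⟩
  · rintro ⟨H, F, j, -, hHF, happ⟩ C hC W hW -
    -- Internality of `j` provides a standard set `J` with `j ∈ *J`. With `J` as the bound for maps,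
    -- all parameters of the existence formula are standard, and it transfers back.
    obtain ⟨J, hJ, hj⟩ := happ.internal
    have key := (U.holds_iff (existsApproximationFormula L)
      (assign [⟨∅, hemp⟩, ⟨U.X, hX⟩, ⟨_, hAs.1⟩,
        ⟨_, (hc.isStdSet_setCode C).1⟩, ⟨_, (hc.isStdSet_relCode W).1⟩, ⟨K, hKs.1⟩,
        ⟨∅, hemp⟩, ⟨_, hJ.1⟩, ⟨_, hopV⟩, ⟨_, hS.1⟩])).2
      ((holds_existsApproximationFormula_star hc hKs hN hop
        (by exact NonstandardUniverse.star_empty) (by exact U.star_X) (by exact rfl)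
        (by exact (hc.isStdSet_setCode C).star_notMem) (by exact rfl) (by exact hJ.star_notMem)
        (by exact rfl) (by exact rfl)).2
        ⟨H, F, hHF, j, hj, happ.isFunc, happ.isCodedApproximation hc hC hW⟩)
    obtain ⟨H, F, hHF, j, -, hjf, h⟩ := (holds_existsApproximationFormula_standard hc hKs hN hop
      (by exact rfl) (by exact rfl) (by exact rfl) (by exact (hc.isStdSet_setCode C).2)
      (by exact rfl) (by exact hJ.2) (by exact rfl) (by exact rfl)).1 key
    exact hK.exists_isApproximation hc hHF hjf h
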